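/- Fix a nonprincipal ultrafilter on $\mathbb N$ and let ${}^{\ast}\mathbb N,{}^{\ast}\mathbb Z,{}^{\ast}\mathbb R$ and ${}^{\ast}\tilde Z:={}^{\ast}(\mathbb Z[X])$ be the corresponding ultrapowers; degree, height $\mathfrak h$ (maximum of the absolute values of the coefficients), evaluation at a real number and real powers are extended componentwise, with $\deg 0=0$. Let $({}^{\ast}\mathbb R_{\rm fin})^{\times}_{+}$ be the group of those ${}^{\ast}u\in{}^{\ast}\mathbb R$ that lie between two positive standard reals. The growth–decay semiring is ${}^{\star}\mathbb P\mathbb R=({}^{\ast}\mathbb R_{+}\cup\{0\})/({}^{\ast}\mathbb R_{\rm fin})^{\times}_{+}$, with $\mu<\mu'$ if $x<x'$ for all representatives $x$ of $\mu$ and $x'$ of $\mu'$. The group $({}^{\ast}\mathbb R_{\rm fin})^{\times}_{+}$ acts on it by $\mu\mapsto\mu^{r}$ (the class of $x^{r}$), and the set of orbits is the Frobenius growth–decay semiring ${}^{\star}\overline{\mathbb P\mathbb R}$, in which $\bar\mu<\bar\nu$ if $\mu<\nu$ for all $\mu\in\bar\mu$, $\nu\in\bar\nu$, and $\bar\mu\le\bar\nu$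 if $\bar\mu<\bar\nu$ or $\bar\mu=\bar\nu$. Write $[x]$ for the class of $|x|$, $x\in{}^{\ast}\mathbb R$, in ${}^{\star}\overline{\mathbb P\mathbb R}$. For $\theta\in\mathbb R$, $d,e\in{}^{\ast}\mathbb N$ with $d,e\ge 1$, and $\bar\mu,\bar\nu\in{}^{\star}\overline{\mathbb P\mathbb R}$ let ${}^{\ast}\tilde Z^{\bar\mu}(\theta)_{d}$ be the set of all $f\in{}^{\ast}\tilde Z$ with $f(\theta)$ infinitesimal, $\deg f\le d$, and $f=0$ or $[\mathfrak h(f)^{-1/d}]>\bar\mu$. Let ${}^{\ast}\tilde Z^{\bar\mu}_{\bar\nu^{e}}(\theta)_{d}$ be the set of those $f\in{}^{\ast}\tilde Z^{\bar\mu}(\theta)_{d}$ for which moreover $[(|f(\theta)|^{1/d})^{1/e}]\le\bar\nu$. Write ${}^{\ast}\tilde Z^{\bar\mu}_{\bar\nu}(\theta)_{d}$ for this set when $e=1$. The resultant product of nonzero $f=a\prod_{i=1}^{m}(X-\alpha_i)$ and $g=b\prod_{j=1}^{n}(X-\beta_j)$ in $\mathbb Z[X]$ (roots in $\mathbb C$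 with multiplicity) is $f\boxtimes g=a^{n}b^{m}\prod_{i,j}(X-\alpha_i\beta_j)\in\mathbb Z[X]$; put $f\boxtimes 0=0\boxtimes f=0$. Extend $\boxtimes$ componentwise to ${}^{\ast}\tilde Z$. Theorem. Let $\theta,\eta\in\mathbb R$, and let $\bar\mu\ge\bar\nu$ in ${}^{\star}\overline{\mathbb P\mathbb R}$, where $\bar\mu$ is the class of an infinitesimal. Then $\boxtimes$ restricts to well-defined maps as follows. (A) (Arbitrary degrees.) For all $d,e\in{}^{\ast}\mathbb N$ with $d,e\ge1$, $${}^{\ast}\tilde Z^{\bar\mu}_{\bar\nu^{e}}(\theta)_{d}\times{}^{\ast}\tilde Z^{\bar\nu}_{\bar\nu^{d}}(\eta)_{e}\xrightarrow{\ \boxtimes\ }{}^{\ast}\tilde Z^{\bar\nu}(\theta\eta)_{de}.$$ If $d=1$, also $${}^{\ast}\tilde Z^{\bar\mu}_{\bar\nu^{e}}(\theta)_{1}\times{}^{\ast}\tilde Z^{\bar\nu}_{\bar\mu}(\eta)_{e}\xrightarrow{\ \boxtimes\ }{}^{\ast}\tilde Z^{\bar\nu}(\theta\eta)_{e},$$ and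 if $e=1$, also $${}^{\ast}\tilde Z^{\bar\nu}_{\bar\mu}(\theta)_{d}\times{}^{\ast}\tilde Z^{\bar\mu}_{\bar\nu^{d}}(\eta)_{1}\xrightarrow{\ \boxtimes\ }{}^{\ast}\tilde Z^{\bar\nu}(\theta\eta)_{d}.$$ (B) (Finite degrees.) For all standard integers $d,e\ge 1$, $${}^{\ast}\tilde Z^{\bar\mu}_{\bar\nu}(\theta)_{d}\times{}^{\ast}\tilde Z^{\bar\nu}_{\bar\nu}(\eta)_{e}\xrightarrow{\ \boxtimes\ }{}^{\ast}\tilde Z^{\bar\nu}(\theta\eta)_{de},\qquad {}^{\ast}\tilde Z^{\bar\mu}_{\bar\nu}(\theta)_{1}\times{}^{\ast}\tilde Z^{\bar\nu}_{\bar\mu}(\eta)_{e}\xrightarrow{\ \boxtimes\ }{}^{\ast}\tilde Z^{\bar\nu}(\theta\eta)_{e},$$ $${}^{\ast}\tilde Z^{\bar\nu}_{\bar\mu}(\theta)_{d}\times{}^{\ast}\tilde Z^{\bar\mu}_{\bar\nu}(\eta)_{1}\xrightarrow{\ \boxtimes\ }{}^{\ast}\tilde Z^{\bar\nu}(\theta\eta)_{d}.$$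 For $d=e=1$ this is the product of numerator–denominator pairs: $(bX-a)\boxtimes(b'X-a')=bb'X-aa'$ for all $a,a',b,b'\in{}^{\ast}\mathbb Z$ with $b,b'\ne0$. (C) The product $\boxtimes$ is bilinear for the usual (Cauchy) product of polynomials: $(ff')\boxtimes g=(f\boxtimes g)(f'\boxtimes g)$ and $f\boxtimes(gg')=(f\boxtimes g)(f\boxtimes g')$ for all $f,f',g,g'\in{}^{\ast}\tilde Z$; and $f\boxtimes g\ne0$ if $f\neq 0$ and $g\ne0$. -/

import Mathlib

open Polynomial Filter

namespace PolyApprox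

/-! ### The resultant product of polynomials -/

section ResultantProduct

/-- For `f = a ∏ (X - αᵢ)` of degree `m` and `g = b ∏ (X - βⱼ)` of degree `n` over `ℂ`
(roots with multiplicity) this is `aⁿ bᵐ ∏ᵢⱼ (X - αᵢ βⱼ)`. The product is `0` if `f` or `g`
is `0`; if `f` or `g` is `1`, then the product is `1`. -/
noncomputable def complexResultantProduct (f g : ℂ[X]) : ℂ[X] :=
  open Classical in
  if f = 0 ∨ g = 0 then 0
  else C (f.leadingCoeff ^ g.natDegree * g.leadingCoeff ^ f.natDegree) *
    ((f.roots ×ˢ g.roots).map fun p => X - C (p.1 * p.2)).prod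

theorem scaleRoots_eq_prod (f : ℂ[X]) (b : ℂ) :
    f.scaleRoots b = C f.leadingCoeff * (f.roots.map fun a => X - C (a * b)).prod := by
  have hf : f.Splits := IsAlgClosed.splits f
  have key : ∀ s : Multiset ℂ, ((s.map fun a => X - C a).prod).scaleRoots b
      = (s.map fun a => X - C (a * b)).prod := by
    intro s
    induction s using Multiset.induction_on with
    | empty => simp
    | cons a s ih =>
      simp only [Multiset.map_cons, Multiset.prod_cons]
      rw [mul_scaleRoots_of_noZeroDivisors, ih, X_sub_C_scaleRoots]
  conv_lhs => rw [hf.eq_prod_roots]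
  rw [mul_scaleRoots_of_noZeroDivisors, scaleRoots_C, key]

theorem exists_int_map_eq_complexResultantProduct (f g : ℤ[X]) :
    ∃ h : ℤ[X], h.map (Int.castRingHom ℂ) =
      complexResultantProduct (f.map (Int.castRingHom ℂ)) (g.map (Int.castRingHom ℂ)) := by
  classical
  by_cases h0 : f.map (Int.castRingHom ℂ) = 0 ∨ g.map (Int.castRingHom ℂ) = 0
  · exact ⟨0, by rw [complexResultantProduct, if_pos h0]; simp⟩
  set F := f.map (Int.castRingHom ℂ) with hF
  set G := g.map (Int.castRingHom ℂ) with hG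
  have hinj : Function.Injective (Int.castRingHom ℂ) := Int.cast_injective
  let P : (ℤ[X])[X] := ∑ i ∈ Finset.range (f.natDegree + 1),
    C (C (f.coeff i) * X ^ i) * X ^ (f.natDegree - i)
  let φ : ℤ[X] →+* ℂ[X] := mapRingHom (Int.castRingHom ℂ)
  have hFd : F.natDegree = f.natDegree := natDegree_map_eq_of_injective hinj f
  have hP : P.natDegree ≤ f.natDegree := by
    refine natDegree_sum_le_of_forall_le _ _ fun i _ => ?_
    exact (natDegree_C_mul_X_pow_le _ _).trans (Nat.sub_le _ _)
  have heval : ∀ b : ℂ, (P.map φ).eval (C b) = F.scaleRoots b := by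
    intro b
    have h1 : F.scaleRoots b = ∑ i ∈ Finset.range (f.natDegree + 1),
        C (F.coeff i * b ^ (f.natDegree - i)) * X ^ i := by
      rw [as_sum_range_C_mul_X_pow (F.scaleRoots b), natDegree_scaleRoots, hFd]
      simp [coeff_scaleRoots, hFd]
    rw [h1]
    simp only [P, Polynomial.map_sum, eval_finsetSum]
    refine Finset.sum_congr rfl fun i _ => ?_
    simp [φ, hF]
    ring
  refine ⟨(g.map C).resultant P (g.map C).natDegree f.natDegree, ?_⟩
  have hGs : (G.map C).Splits := (IsAlgClosed.splits G).map C
  have hGm : ((g.map C).map φ : (ℂ[X])[X]) = G.map C := by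
    ext1 n
    simp [φ, hG]
  have hd : (g.map (C : ℤ →+* ℤ[X])).natDegree = (G.map C).natDegree := by
    rw [natDegree_map_eq_of_injective C_injective, natDegree_map_eq_of_injective C_injective,
      natDegree_map_eq_of_injective hinj]
  have hres := resultant_map_map (g.map C) P (g.map C).natDegree f.natDegree φ
  rw [hGm, hd] at hres
  change φ _ = _
  rw [hd, ← hres, resultant_eq_prod_eval _ _ _ (natDegree_map_le.trans hP) hGs,
    (IsAlgClosed.splits G).roots_map, Multiset.map_map, complexResultantProduct, if_neg h0,
    leadingCoeff_map_of_injective C_injective]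
  have h2 : (G.roots.map ((fun x => eval x (P.map φ)) ∘ (C : ℂ → ℂ[X]))) =
      G.roots.map fun b => C F.leadingCoeff * (F.roots.map fun a => X - C (a * b)).prod := by
    refine Multiset.map_congr rfl fun b _ => ?_
    simp only [Function.comp]
    rw [heval, scaleRoots_eq_prod]
  rw [h2, Multiset.prod_map_mul, Multiset.map_const', Multiset.prod_replicate,
    ← (IsAlgClosed.splits G).natDegree_eq_card_roots, C_mul, C_pow, C_pow, hFd]
  have h3 : (G.roots.map fun b => (F.roots.map fun a => X - C (a * b)).prod).prod =
      ((F.roots ×ˢ G.roots).map fun p => X - C (p.1 * p.2)).prod := by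
    rw [Multiset.prod_map_prod_map]
    change _ = (((Multiset.product F.roots G.roots)).map _).prod
    rw [Multiset.product, Multiset.map_bind, Multiset.prod_bind]
    congr 1
    refine Multiset.map_congr rfl fun a _ => ?_
    rw [Multiset.map_map]
    rfl
  rw [h3]
  ring

/-- The resultant product `f ⊠ g` of two polynomials with integer coefficients. -/
noncomputable def resultantProduct (f g : ℤ[X]) : ℤ[X] :=
  Classical.choose (exists_int_map_eq_complexResultantProduct f g)

theorem map_resultantProduct (f g : ℤ[X]) :
    (resultantProduct f g).map (Int.castRingHom ℂ) =
      complexResultantProduct (f.map (Int.castRingHom ℂ)) (g.map (Int.castRingHom ℂ)) :=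
  Classical.choose_spec (exists_int_map_eq_complexResultantProduct f g)

end ResultantProduct

/-! ### Ultrapowers, growth-decay classes and Frobenius classes -/

section GrowthDecay

/-- The ultrapower of `α` over `ℕ`. -/
abbrev UPow (U : Ultrafilter ℕ) (α : Type) : Type := (U : Filter ℕ).Germ α

variable {U : Ultrafilter ℕ}

/-- Powers of elements of `*ℝ`, componentwise. -/
noncomputable def starPow (x r : UPow U ℝ) : UPow U ℝ := Germ.map₂ (fun a b : ℝ => a ^ b) x r

/-- The inclusion `*ℕ ⊆ *ℝ`. -/
noncomputable def natToReal (d : UPow U ℕ) : UPow U ℝ := Germ.map (fun n : ℕ => (n : ℝ)) d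

/-- `x` is infinitesimal (possibly zero or negative). -/
def IsInfinitesimal (x : UPow U ℝ) : Prop := ∀ M : ℝ, 0 < M → |x| < (M : UPow U ℝ)

/-- `u` is a positive unit of the ring of bounded elements of `*ℝ`. -/
def IsPosUnit (u : UPow U ℝ) : Prop :=
  ∃ m M : ℝ, 0 < m ∧ (m : UPow U ℝ) ≤ u ∧ u ≤ (M : UPow U ℝ)

theorem IsPosUnit.pos {u : UPow U ℝ} (h : IsPosUnit u) : 0 < u := by
  obtain ⟨m, M, hm, h1, -⟩ := h
  exact lt_of_lt_of_le (Germ.const_lt hm) h1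

theorem isPosUnit_one : IsPosUnit (1 : UPow U ℝ) := ⟨1, 1, one_pos, le_refl _, le_refl _⟩

theorem IsPosUnit.mul {u v : UPow U ℝ} (hu : IsPosUnit u) (hv : IsPosUnit v) :
    IsPosUnit (u * v) := by
  have hu' := hu.pos
  have hv' := hv.pos
  obtain ⟨m, M, hm, h1, h2⟩ := hu
  obtain ⟨m', M', hm', h1', h2'⟩ := hv
  refine ⟨m * m', M * M', mul_pos hm hm', ?_, ?_⟩
  · change (m : UPow U ℝ) * (m' : UPow U ℝ) ≤ u * v
    exact mul_le_mul h1 h1' (Germ.const_lt hm').le hu'.le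
  · change u * v ≤ (M : UPow U ℝ) * (M' : UPow U ℝ)
    exact mul_le_mul h2 h2' hv'.le (hu'.le.trans h2)

theorem IsPosUnit.inv {u : UPow U ℝ} (hu : IsPosUnit u) : IsPosUnit u⁻¹ := by
  have hu' := hu.pos
  obtain ⟨m, M, hm, h1, h2⟩ := hu
  have hM : 0 < M := Germ.const_lt_iff.1 (lt_of_lt_of_le hu' h2)
  refine ⟨M⁻¹, m⁻¹, inv_pos.2 hM, ?_, ?_⟩
  · rw [Germ.const_inv]
    exact inv_anti₀ hu' h2
  · rw [Germ.const_inv]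
    exact inv_anti₀ (Germ.const_lt hm) h1

theorem starPow_nonneg {x : UPow U ℝ} (hx : 0 ≤ x) (r : UPow U ℝ) : 0 ≤ starPow x r := by
  induction x, r using Germ.inductionOn₂ with
  | _ x r =>
    have hx' : ∀ᶠ i in (U : Filter ℕ), 0 ≤ x i := hx
    exact hx'.mono fun i hi => Real.rpow_nonneg hi _

theorem starPow_one (x : UPow U ℝ) : starPow x 1 = x := by
  induction x using Germ.inductionOn with
  | _ x => exact Germ.coe_eq.2 (Eventually.of_forall fun i => Real.rpow_one _)

theorem starPow_mul {x : UPow U ℝ} (hx : 0 ≤ x) (r s : UPow U ℝ) :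
    starPow x (r * s) = starPow (starPow x r) s := by
  induction x, r, s using Germ.inductionOn₃ with
  | _ x r s =>
    have hx' : ∀ᶠ i in (U : Filter ℕ), 0 ≤ x i := hx
    exact Germ.coe_eq.2 (hx'.mono fun i hi => Real.rpow_mul hi _ _)

theorem mul_starPow {u x : UPow U ℝ} (hu : 0 ≤ u) (hx : 0 ≤ x) (r : UPow U ℝ) :
    starPow (u * x) r = starPow u r * starPow x r := by
  induction u, x, r using Germ.inductionOn₃ with
  | _ u x r =>
    have hu' : ∀ᶠ i in (U : Filter ℕ), 0 ≤ u i := hu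
    have hx' : ∀ᶠ i in (U : Filter ℕ), 0 ≤ x i := hx
    exact Germ.coe_eq.2 ((hu'.and hx').mono fun i hi => Real.mul_rpow hi.1 hi.2)

theorem IsPosUnit.starPow {u r : UPow U ℝ} (hu : IsPosUnit u) (hr : IsPosUnit r) :
    IsPosUnit (starPow u r) := by
  obtain ⟨m, M, hm, h1, h2⟩ := hu
  obtain ⟨a, A, ha, h3, h4⟩ := hr
  refine ⟨min m 1 ^ A, max M 1 ^ A, Real.rpow_pos_of_pos (lt_min hm one_pos) _, ?_, ?_⟩
  all_goals
    induction u, r using Germ.inductionOn₂ with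
    | _ u r =>
      have h1' : ∀ᶠ i in (U : Filter ℕ), m ≤ u i := h1
      have h2' : ∀ᶠ i in (U : Filter ℕ), u i ≤ M := h2
      have h3' : ∀ᶠ i in (U : Filter ℕ), a ≤ r i := h3
      have h4' : ∀ᶠ i in (U : Filter ℕ), r i ≤ A := h4
      refine ((h1'.and h2').and (h3'.and h4')).mono ?_
      rintro i ⟨⟨g1, g2⟩, g3, g4⟩
      have hr0 : 0 ≤ r i := ha.le.trans g3
      first
      | exact (Real.rpow_le_rpow_of_exponent_ge (lt_min hm one_pos) (min_le_right _ _) g4).trans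
          (Real.rpow_le_rpow (lt_min hm one_pos).le ((min_le_left _ _).trans g1) hr0)
      | exact (Real.rpow_le_rpow (hm.le.trans g1) (g2.trans (le_max_left _ _)) hr0).trans
          (Real.rpow_le_rpow_of_exponent_le (le_max_right _ _) g4)

/-- The equivalence relation on the nonnegative elements of `*ℝ` given by the multiplicative
action of the positive units of the ring of bounded elements. -/
def growthDecaySetoid (U : Ultrafilter ℕ) : Setoid {x : UPow U ℝ // 0 ≤ x} where
  r x y := ∃ u : UPow U ℝ, IsPosUnit u ∧ y.1 = u * x.1
  iseqv :=
    { refl := fun x => ⟨1, isPosUnit_one, (one_mul _).symm⟩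
      symm := by
        rintro x y ⟨u, hu, h⟩
        exact ⟨u⁻¹, hu.inv, by rw [h, inv_mul_cancel_left₀ hu.pos.ne']⟩
      trans := by
        rintro x y z ⟨u, hu, h⟩ ⟨v, hv, h'⟩
        exact ⟨v * u, hv.mul hu, by rw [h', h, mul_assoc]⟩ }

/-- The growth-decay semiring `(*ℝ₊ ∪ {0}) / (*ℝ_fin)₊ˣ`, with the class `-∞` of `0` included. -/
def GrowthDecay (U : Ultrafilter ℕ) : Type := Quotient (growthDecaySetoid U)

/-- The class `x · (*ℝ_fin)₊ˣ`. -/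
def GrowthDecay.mk (x : {x : UPow U ℝ // 0 ≤ x}) : GrowthDecay U :=
  Quotient.mk (growthDecaySetoid U) x

/-- `μ < μ'` if `x < x'` for all representatives `x` of `μ` and `x'` of `μ'`. -/
instance : LT (GrowthDecay U) where
  lt μ μ' := ∀ x x' : {x : UPow U ℝ // 0 ≤ x},
    GrowthDecay.mk x = μ → GrowthDecay.mk x' = μ' → x.1 < x'.1

/-- The Frobenius action `μ ↦ μ ^ r` of the positive units of the ring of bounded elements. -/
noncomputable def GrowthDecay.frobenius (r : {r : UPow U ℝ // IsPosUnit r}) :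
    GrowthDecay U → GrowthDecay U :=
  Quotient.map (sa := growthDecaySetoid U) (sb := growthDecaySetoid U)
    (fun x => ⟨starPow x.1 r.1, starPow_nonneg x.2 _⟩) (by
      rintro x y ⟨u, hu, h⟩
      exact ⟨starPow u r.1, hu.starPow r.2, by
        simp only [h, mul_starPow hu.pos.le x.2]⟩)

/-- Two growth-decay classes are equivalent if they are in the same Frobenius orbit. -/
def frobeniusSetoid (U : Ultrafilter ℕ) : Setoid (GrowthDecay U) where
  r μ ν := ∃ r : {r : UPow U ℝ // IsPosUnit r}, ν = GrowthDecay.frobenius r μ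
  iseqv :=
    { refl := by
        intro μ
        refine ⟨⟨1, isPosUnit_one⟩, ?_⟩
        induction μ using Quotient.inductionOn with
        | _ x =>
          refine congrArg (Quotient.mk (growthDecaySetoid U)) (Subtype.ext ?_)
          exact (starPow_one x.1).symm
      symm := by
        rintro μ ν ⟨r, rfl⟩
        refine ⟨⟨r.1⁻¹, r.2.inv⟩, ?_⟩
        induction μ using Quotient.inductionOn with
        | _ x =>
          refine congrArg (Quotient.mk (growthDecaySetoid U)) (Subtype.ext ?_)
          change x.1 = starPow (starPow x.1 r.1) r.1⁻¹
          rw [← starPow_mul x.2, mul_inv_cancel₀ r.2.pos.ne', starPow_one]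
      trans := by
        rintro μ ν ξ ⟨r, rfl⟩ ⟨s, rfl⟩
        refine ⟨⟨r.1 * s.1, r.2.mul s.2⟩, ?_⟩
        induction μ using Quotient.inductionOn with
        | _ x =>
          refine congrArg (Quotient.mk (growthDecaySetoid U)) (Subtype.ext ?_)
          exact (starPow_mul x.2 r.1 s.1).symm }

/-- The Frobenius growth-decay semiring: the quotient of the growth-decay semiring by the
Frobenius action. -/
def FrobGrowthDecay (U : Ultrafilter ℕ) : Type := Quotient (frobeniusSetoid U)

/-- The Frobenius orbit of a growth-decay class. -/
def FrobGrowthDecay.mk (μ : GrowthDecay U) : FrobGrowthDecay U :=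
  Quotient.mk (frobeniusSetoid U) μ

/-- `μ̄ < ν̄` if `μ < ν` for all `μ` in `μ̄` and `ν` in `ν̄`. -/
instance : LT (FrobGrowthDecay U) where
  lt μ ν := ∀ x y : GrowthDecay U, FrobGrowthDecay.mk x = μ → FrobGrowthDecay.mk y = ν → x < y

instance : LE (FrobGrowthDecay U) where
  le μ ν := μ < ν ∨ μ = ν

/-- The image `[x]` of `x ∈ *ℝ` in the Frobenius growth-decay semiring, the class of `|x|`. -/
noncomputable def frobClass (x : UPow U ℝ) : FrobGrowthDecay U :=
  FrobGrowthDecay.mk (GrowthDecay.mk ⟨|x|, abs_nonneg x⟩)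

/-- `μ̄` is the class of an infinitesimal (the class `-∞` of `0` is allowed). -/
def IsDecay (μ : FrobGrowthDecay U) : Prop :=
  ∃ x : UPow U ℝ, IsInfinitesimal x ∧ frobClass x = μ

end GrowthDecay

/-! ### Polynomial diophantine approximations -/

section Approximations

variable {U : Ultrafilter ℕ}

/-- The degree of an element of `*(ℤ[X])`, with `deg 0 = 0`. -/
noncomputable def starDeg (f : UPow U ℤ[X]) : UPow U ℕ := Germ.map natDegree f

/-- The height of an element of `*(ℤ[X])`: the maximum of the absolute values of
the coefficients, componentwise. -/
noncomputable def starHeight (f : UPow U ℤ[X]) : UPow U ℝ := Germ.map supNorm f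

/-- The value of an element of `*(ℤ[X])` at a real number. -/
noncomputable def starEval (θ : ℝ) (f : UPow U ℤ[X]) : UPow U ℝ := Germ.map (fun p => aeval θ p) f

/-- The resultant product on `*(ℤ[X])`. -/
noncomputable def starResultantProduct (f g : UPow U ℤ[X]) : UPow U ℤ[X] :=
  Germ.map₂ resultantProduct f g

infixl:70 " ⊠ " => starResultantProduct

/-- The linear polynomial `b X - a` with coefficients in `*ℤ`. -/
noncomputable def starLinear (b a : UPow U ℤ) : UPow U ℤ[X] :=
  Germ.map₂ (fun b a : ℤ => C b * X - C a) b a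

/-- The growth class `μ̄_d(f) = [(height f ^ (1 / d))⁻¹]`, for `f ≠ 0`. -/
noncomputable def growth (d : UPow U ℕ) (f : UPow U ℤ[X]) : FrobGrowthDecay U :=
  frobClass (starPow (starHeight f) (natToReal d)⁻¹)⁻¹

/-- The class `ν̄_d(f) ^ (1 / e)`, where `ν̄_d(f) = [|f(θ)| ^ (1 / d)]`; it is the class of
`(|f(θ)| ^ (1 / d)) ^ (1 / e)`. For `e = 1` it is `ν̄_d(f)` itself. -/
noncomputable def decayRoot (θ : ℝ) (d e : UPow U ℕ) (f : UPow U ℤ[X]) : FrobGrowthDecay U :=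
  frobClass (starPow (starPow |starEval θ f| (natToReal d)⁻¹) (natToReal e)⁻¹)

/-- `*Z̃^μ̄(θ)_d`: the polynomials `f` with `f(θ)` infinitesimal, `deg f ≤ d` and `μ̄ < μ̄_d(f)`;
the zero polynomial belongs to it (its growth class counts as `+∞`). -/
def approxSet (μ : FrobGrowthDecay U) (θ : ℝ) (d : UPow U ℕ) : Set (UPow U ℤ[X]) :=
  {f | IsInfinitesimal (starEval θ f) ∧ starDeg f ≤ d ∧ (f = 0 ∨ μ < growth d f)}

/-- The set of those `f` in `*Z̃^μ̄(θ)_d` for which `ν̄_d(f) ^ (1 / e) ≤ ν̄`; this is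
`*Z̃^μ̄_(ν̄^e)(θ)_d`, and for `e = 1` it is `*Z̃^μ̄_ν̄(θ)_d`. -/
def approxIdeal (μ ν : FrobGrowthDecay U) (e : UPow U ℕ) (θ : ℝ) (d : UPow U ℕ) :
    Set (UPow U ℤ[X]) :=
  {f | f ∈ approxSet μ θ d ∧ decayRoot θ d e f ≤ ν}

end Approximations

end PolyApprox

open PolyApprox

/-!
Two elementary estimates for integer polynomials `f = a ∏ (X - αᵢ)` and `g = b ∏ (X - βⱼ)` of
degrees `m` and `n` carry the proof.

*Height.* The number `|a| ∏ (1 + |αᵢ|)` (`rootSize`) is at most `4 ^ m h(f)` by way of the Mahler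
measure, and it bounds the coefficients. As `1 + |αβ| ≤ (1 + |α|) (1 + |β|)`, the height of `f ⊠ g`
is at most `C ^ (m n) h(f) ^ n h(g) ^ m` with an absolute constant `C`.

*Value.* Let `α` and `β` be the roots of `f` and `g` that are nearest to `x` and `y`. If
`|y - β| ≤ |x - α|`, then
`|x y - αᵢ β| = |(x - αᵢ) β + x (y - β)| ≤ |x - αᵢ| (|β| + |x|)` for all `i`. The product over `i`
of these factors yields `f(x)`, and a trivial bound for the remaining factors gives
`|(f ⊠ g)(x y)| ≤ C ^ (m n) |f(x)| h(f) ^ (n - 1) h(g) ^ m`, now with `C` depending on `x` and `y`.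
Otherwise the roles are exchanged, and
`|(f ⊠ g)(x y)| ≤ C ^ (m n) |g(y)| h(f) ^ n h(g) ^ (m - 1)` (`abs_aeval_resultantProduct_le_or`).
No factor grows faster than `C ^ (m n)`, and this is why infinite degrees are allowed; the
exponent `m - 1`, which is `0` for linear `f`, is why the indices can be adjusted in that case.

With `A = h(f) ^ (1 / d)`, `B = h(g) ^ (1 / e)`, `F = |f(θ)| ^ (1 / (d e))` and
`G = |g(η)| ^ (1 / (d e))` the estimates become `h(f ⊠ g) ^ (1 / (d e)) ≤ C A B` and
`|(f ⊠ g)(θ η)| ≤ max (C F A B, C G A B) ^ (d e)`, and the theorem reduces to the order of the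
Frobenius growth-decay semiring. Let `μ` and `ν` be the classes of infinitesimals `x` and `y`. The
conditions `μ < [A⁻¹]` and `ν < [B⁻¹]` say that `x A ^ k ≤ 1` and `y B ^ k ≤ 1` for all standard `k`
(`frobClass_lt_inv_iff`), whereas `ν ≤ μ` and `[F] ≤ ν` say that standard powers of `y` and `F` are
at most `x` and `y` (`exists_pow_le_of_frobClass_le`). Such relations are stable under products and
roots, which gives `ν < [(C A B)⁻¹]` and shows that `F A B` and `G A B` are infinitesimal. For
`d = 1` the number `G A` takes the place of `G A B`, and it is infinitesimal already if `[G] ≤ μ`.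
For standard `d` and `e` the additional roots do not change Frobenius classes, so that the case of
finite degrees is part of the general one.
-/

namespace PolyApprox

/-! ### Algebra of the resultant product -/

theorem prod_map_product {α β M : Type*} [CommMonoid M] (s : Multiset α) (t : Multiset β)
    (F : α → β → M) :
    ((s ×ˢ t).map fun p => F p.1 p.2).prod = (s.map fun a => (t.map fun b => F a b).prod).prod := by
  change ((Multiset.product s t).map _).prod = _
  rw [Multiset.product, Multiset.map_bind, Multiset.prod_bind]
  congr 1
  refine Multiset.map_congr rfl fun a _ => ?_
  rw [Multiset.map_map]
  rfl

theorem complexResultantProduct_zero_left (g : ℂ[X]) : complexResultantProduct 0 g = 0 := by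
  simp [complexResultantProduct]

theorem complexResultantProduct_of_ne_zero {f g : ℂ[X]} (hf : f ≠ 0) (hg : g ≠ 0) :
    complexResultantProduct f g =
      C (f.leadingCoeff ^ g.natDegree * g.leadingCoeff ^ f.natDegree) *
        (f.roots.map fun a => (g.roots.map fun b => X - C (a * b)).prod).prod := by
  rw [complexResultantProduct, if_neg (by tauto), prod_map_product f.roots g.roots
    fun a b => X - C (a * b)]

theorem complexResultantProduct_comm (f g : ℂ[X]) :
    complexResultantProduct f g = complexResultantProduct g f := by
  by_cases h : f = 0 ∨ g = 0
  · rw [complexResultantProduct, complexResultantProduct, if_pos h, if_pos h.symm]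
  · push Not at h
    rw [complexResultantProduct_of_ne_zero h.1 h.2, complexResultantProduct_of_ne_zero h.2 h.1,
      Multiset.prod_map_prod_map, mul_comm (f.leadingCoeff ^ _)]
    simp only [mul_comm]

theorem complexResultantProduct_ne_zero {f g : ℂ[X]} (hf : f ≠ 0) (hg : g ≠ 0) :
    complexResultantProduct f g ≠ 0 := by
  rw [complexResultantProduct, if_neg (by tauto)]
  refine mul_ne_zero ?_ (monic_multiset_prod_of_monic _ _ fun p _ => monic_X_sub_C _).ne_zero
  rw [Ne, C_eq_zero]
  exact mul_ne_zero (pow_ne_zero _ (leadingCoeff_ne_zero.2 hf))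
    (pow_ne_zero _ (leadingCoeff_ne_zero.2 hg))

theorem natDegree_complexResultantProduct_le (f g : ℂ[X]) :
    (complexResultantProduct f g).natDegree ≤ f.natDegree * g.natDegree := by
  rw [complexResultantProduct]
  split_ifs with h
  · simp
  · refine (natDegree_C_mul_le _ _).trans ?_
    have h1 : ((f.roots ×ˢ g.roots).map fun p => X - C (p.1 * p.2)) =
        ((f.roots ×ˢ g.roots).map fun p => p.1 * p.2).map fun a => X - C a := by
      rw [Multiset.map_map]; rfl
    rw [h1, natDegree_multiset_prod_X_sub_C_eq_card, Multiset.card_map, Multiset.card_product]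
    exact Nat.mul_le_mul (card_roots' f) (card_roots' g)

theorem complexResultantProduct_mul_left (f f' g : ℂ[X]) :
    complexResultantProduct (f * f') g =
      complexResultantProduct f g * complexResultantProduct f' g := by
  by_cases hf : f = 0
  · simp [hf, complexResultantProduct]
  by_cases hf' : f' = 0
  · simp [hf', complexResultantProduct]
  by_cases hg : g = 0
  · simp [hg, complexResultantProduct]
  rw [complexResultantProduct_of_ne_zero (mul_ne_zero hf hf') hg,
    complexResultantProduct_of_ne_zero hf hg, complexResultantProduct_of_ne_zero hf' hg,
    roots_mul (mul_ne_zero hf hf'), natDegree_mul hf hf', leadingCoeff_mul, Multiset.map_add,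
    Multiset.prod_add]
  simp only [C_mul, C_pow]
  ring

theorem complexResultantProduct_linear {a b a' b' : ℂ} (hb : b ≠ 0) (hb' : b' ≠ 0) :
    complexResultantProduct (C b * X - C a) (C b' * X - C a') =
      C (b * b') * X - C (a * a') := by
  have hd : ∀ a b : ℂ, b ≠ 0 → (C b * X - C a).natDegree = 1 := by
    intro a b hb
    rw [sub_eq_add_neg, ← C_neg, natDegree_linear hb]
  have hl : ∀ a b : ℂ, b ≠ 0 → (C b * X - C a).leadingCoeff = b := by
    intro a b hb
    rw [sub_eq_add_neg, ← C_neg, leadingCoeff_linear hb]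
  have h0 : ∀ a b : ℂ, b ≠ 0 → C b * X - C a ≠ 0 := by
    intro a b hb h
    have := hl a b hb
    rw [h, leadingCoeff_zero] at this
    exact hb this.symm
  have hr : ∀ a b : ℂ, b ≠ 0 → (C b * X - C a).roots = {b⁻¹ * a} := fun a b hb =>
    roots_C_mul_X_sub_C a hb
  rw [complexResultantProduct_of_ne_zero (h0 _ _ hb) (h0 _ _ hb'), hd _ _ hb, hd _ _ hb',
    hl _ _ hb, hl _ _ hb', hr _ _ hb, hr _ _ hb']
  simp only [pow_one, Multiset.map_singleton, Multiset.prod_singleton]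
  rw [mul_sub, ← C_mul]
  congr 2
  field_simp

theorem int_map_injective : Function.Injective (Polynomial.map (Int.castRingHom ℂ)) :=
  map_injective _ Int.cast_injective

theorem resultantProduct_comm (f g : ℤ[X]) : resultantProduct f g = resultantProduct g f :=
  int_map_injective (by
    rw [map_resultantProduct, map_resultantProduct, complexResultantProduct_comm])

theorem resultantProduct_zero_left (g : ℤ[X]) : resultantProduct 0 g = 0 :=
  int_map_injective (by
    rw [map_resultantProduct, Polynomial.map_zero, complexResultantProduct_zero_left])

theorem resultantProduct_mul_left (f f' g : ℤ[X]) :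
    resultantProduct (f * f') g = resultantProduct f g * resultantProduct f' g :=
  int_map_injective (by
    rw [Polynomial.map_mul]
    simp only [map_resultantProduct, Polynomial.map_mul, complexResultantProduct_mul_left])

theorem resultantProduct_ne_zero {f g : ℤ[X]} (hf : f ≠ 0) (hg : g ≠ 0) :
    resultantProduct f g ≠ 0 := by
  have h0 : ∀ p : ℤ[X], p ≠ 0 → p.map (Int.castRingHom ℂ) ≠ 0 := fun p hp =>
    (map_ne_zero_iff (mapRingHom (Int.castRingHom ℂ)) int_map_injective).2 hp
  intro h
  apply complexResultantProduct_ne_zero (h0 f hf) (h0 g hg)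
  rw [← map_resultantProduct, h, Polynomial.map_zero]

theorem natDegree_resultantProduct_le (f g : ℤ[X]) :
    (resultantProduct f g).natDegree ≤ f.natDegree * g.natDegree := by
  have hd : ∀ p : ℤ[X], (p.map (Int.castRingHom ℂ)).natDegree = p.natDegree := fun p =>
    natDegree_map_eq_of_injective Int.cast_injective p
  rw [← hd, ← hd f, ← hd g, map_resultantProduct]
  exact natDegree_complexResultantProduct_le _ _

theorem resultantProduct_linear {a b a' b' : ℤ} (hb : b ≠ 0) (hb' : b' ≠ 0) :
    resultantProduct (C b * X - C a) (C b' * X - C a') = C (b * b') * X - C (a * a') := by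
  apply int_map_injective
  rw [map_resultantProduct]
  simpa using complexResultantProduct_linear (a := a) (a' := a')
    (Int.cast_ne_zero.2 hb) (Int.cast_ne_zero.2 hb')

/-! ### Size of the resultant product -/

/-- The quantity `|a| ∏ (1 + |αᵢ|)` attached to `a ∏ (X - αᵢ)`. It dominates the coefficients, is
multiplicative in the same way as the leading coefficient and the roots, and is at most `4 ^ m`
times the height in degree `m`. -/
noncomputable def rootSize (p : ℂ[X]) : ℝ :=
  ‖p.leadingCoeff‖ * (p.roots.map fun a => 1 + ‖a‖).prod

theorem one_le_prod_one_add_norm (s : Multiset ℂ) : 1 ≤ (s.map fun a => 1 + ‖a‖).prod := by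
  refine Multiset.one_le_prod fun x hx => ?_
  obtain ⟨a, -, rfl⟩ := Multiset.mem_map.1 hx
  linarith [norm_nonneg a]

theorem rootSize_nonneg (p : ℂ[X]) : 0 ≤ rootSize p :=
  mul_nonneg (norm_nonneg _) (zero_le_one.trans (one_le_prod_one_add_norm _))

theorem rootSize_le_two_pow_mul_mahlerMeasure (p : ℂ[X]) :
    rootSize p ≤ 2 ^ p.natDegree * p.mahlerMeasure := by
  have h : (p.roots.map fun a => 1 + ‖a‖).prod ≤
      (p.roots.map fun a => 2 * max 1 ‖a‖).prod :=
    Multiset.prod_map_le_prod_map₀ _ _ (fun a _ => by positivity)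
      fun a _ => by linarith [le_max_left 1 ‖a‖, le_max_right 1 ‖a‖]
  rw [Multiset.prod_map_mul, Multiset.map_const', Multiset.prod_replicate,
    ← (IsAlgClosed.splits p).natDegree_eq_card_roots] at h
  rw [rootSize, mahlerMeasure_eq_leadingCoeff_mul_prod_roots]
  calc _ ≤ ‖p.leadingCoeff‖ * _ := mul_le_mul_of_nonneg_left h (norm_nonneg _)
    _ = _ := by ring

theorem rootSize_map_le (f : ℤ[X]) :
    rootSize (f.map (Int.castRingHom ℂ)) ≤ 4 ^ f.natDegree * f.supNorm := by
  set F := f.map (Int.castRingHom ℂ) with hF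
  have hd : F.natDegree = f.natDegree := natDegree_map_eq_of_injective Int.cast_injective f
  have hM : F.mahlerMeasure ≤ 2 ^ f.natDegree * f.supNorm := by
    refine (mahlerMeasure_le_sum_norm_coeff F).trans ?_
    rw [sum_over_range _ (by simp), hd]
    calc _ ≤ ∑ _i ∈ Finset.range (f.natDegree + 1), f.supNorm := by
            refine Finset.sum_le_sum fun i _ => ?_
            have := f.le_supNorm i
            simpa [hF, Int.norm_eq_abs] using this
      _ = (f.natDegree + 1 : ℕ) * f.supNorm := by simp
      _ ≤ _ := by
            refine mul_le_mul_of_nonneg_right ?_ f.supNorm_nonneg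
            exact_mod_cast Nat.lt_two_pow_self
  have h := rootSize_le_two_pow_mul_mahlerMeasure F
  rw [hd] at h
  calc _ ≤ (2 : ℝ) ^ f.natDegree * (2 ^ f.natDegree * f.supNorm) :=
        h.trans (mul_le_mul_of_nonneg_left hM (by positivity))
    _ = _ := by rw [← mul_assoc, ← mul_pow]; norm_num

theorem norm_coeff_prod_X_sub_C_le (s : Multiset ℂ) (k : ℕ) :
    ‖((s.map fun a => X - C a).prod).coeff k‖ ≤ (s.map fun a => 1 + ‖a‖).prod := by
  induction s using Multiset.induction_on generalizing k with
  | empty =>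
    simp only [Multiset.map_zero, Multiset.prod_zero, coeff_one]
    split_ifs <;> simp
  | cons a s ih =>
    simp only [Multiset.map_cons, Multiset.prod_cons]
    set q := (s.map fun a => X - C a).prod
    set B := (s.map fun a => 1 + ‖a‖).prod
    have hB : 0 ≤ B := zero_le_one.trans (one_le_prod_one_add_norm s)
    have h1 : ‖(X * q).coeff k‖ ≤ B := by
      cases k with
      | zero => simpa using hB
      | succ k => simpa [coeff_X_mul] using ih k
    have h2 : ‖(C a * q).coeff k‖ ≤ ‖a‖ * B := by
      rw [coeff_C_mul, norm_mul]
      exact mul_le_mul_of_nonneg_left (ih k) (norm_nonneg a)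
    rw [sub_mul, coeff_sub]
    linarith [norm_sub_le ((X * q).coeff k) ((C a * q).coeff k)]

/-- The coefficients are bounded with `1 + |a b| ≤ (1 + |a|) (1 + |b|)` for the roots. -/
theorem norm_coeff_complexResultantProduct_le {f g : ℂ[X]} (hf : f ≠ 0) (hg : g ≠ 0) (k : ℕ) :
    ‖(complexResultantProduct f g).coeff k‖ ≤
      rootSize f ^ g.natDegree * rootSize g ^ f.natDegree := by
  have hfd := (IsAlgClosed.splits f).natDegree_eq_card_roots
  have hgd := (IsAlgClosed.splits g).natDegree_eq_card_roots
  have h1 : ((f.roots ×ˢ g.roots).map fun p => X - C (p.1 * p.2)) =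
      ((f.roots ×ˢ g.roots).map fun p => p.1 * p.2).map fun a => X - C a := by
    rw [Multiset.map_map]; rfl
  have h2 : ((f.roots ×ˢ g.roots).map fun p => 1 + ‖p.1 * p.2‖).prod ≤
      ((f.roots ×ˢ g.roots).map fun p => (1 + ‖p.1‖) * (1 + ‖p.2‖)).prod := by
    refine Multiset.prod_map_le_prod_map₀ _ _ (fun _ _ => by positivity) fun p _ => ?_
    rw [norm_mul]
    nlinarith [norm_nonneg p.1, norm_nonneg p.2]
  have h3 : ((f.roots ×ˢ g.roots).map fun p => (1 + ‖p.1‖) * (1 + ‖p.2‖)).prod =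
      (f.roots.map fun a => 1 + ‖a‖).prod ^ g.natDegree *
        (g.roots.map fun b => 1 + ‖b‖).prod ^ f.natDegree := by
    rw [prod_map_product f.roots g.roots fun a b => (1 + ‖a‖) * (1 + ‖b‖)]
    simp only [Multiset.prod_map_mul, Multiset.map_const', Multiset.prod_replicate,
      Multiset.prod_map_pow, ← hfd, ← hgd]
  rw [complexResultantProduct, if_neg (by tauto), coeff_C_mul, h1, norm_mul, norm_mul, norm_pow,
    norm_pow, rootSize, rootSize, mul_pow, mul_pow]
  refine (mul_le_mul_of_nonneg_left ((norm_coeff_prod_X_sub_C_le _ k).trans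
    (le_of_eq_of_le (by rw [Multiset.map_map]; rfl) (h2.trans_eq h3))) (by positivity)).trans_eq ?_
  ring

theorem norm_multiset_prod_map {α : Type*} (s : Multiset α) (F : α → ℂ) :
    ‖(s.map F).prod‖ = (s.map fun a => ‖F a‖).prod := by
  rw [show ‖(s.map F).prod‖ = normHom (s.map F).prod from rfl, map_multiset_prod,
    Multiset.map_map]
  rfl

theorem norm_eval_eq (p : ℂ[X]) (x : ℂ) :
    ‖p.eval x‖ = ‖p.leadingCoeff‖ * (p.roots.map fun a => ‖x - a‖).prod := by
  conv_lhs => rw [(IsAlgClosed.splits p).eq_prod_roots]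
  rw [eval_mul, eval_C, eval_multiset_prod, norm_mul, Multiset.map_map, norm_multiset_prod_map]
  simp

theorem norm_eval_complexResultantProduct {f g : ℂ[X]} (hf : f ≠ 0) (hg : g ≠ 0) (z : ℂ) :
    ‖(complexResultantProduct f g).eval z‖ =
      ‖f.leadingCoeff‖ ^ g.natDegree * ‖g.leadingCoeff‖ ^ f.natDegree *
        (g.roots.map fun b => (f.roots.map fun a => ‖z - a * b‖).prod).prod := by
  rw [complexResultantProduct_of_ne_zero hf hg, eval_mul, eval_C, norm_mul, norm_mul, norm_pow,
    norm_pow, Multiset.prod_map_prod_map, eval_multiset_prod, Multiset.map_map,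
    norm_multiset_prod_map]
  congr 2
  refine Multiset.map_congr rfl fun b _ => ?_
  rw [Function.comp_apply, eval_multiset_prod, Multiset.map_map, norm_multiset_prod_map]
  simp

/-- If a root `b` of `g` is at least as near to `y` as all roots of `f` are to `x`, then
`f(x)` controls the value of the resultant product at `x y`: for this `b` one has
`|x y - a b| ≤ |x - a| (|b| + |x|)`, and all other factors are bounded trivially. -/
theorem norm_eval_complexResultantProduct_le {f g : ℂ[X]} (hf : f ≠ 0) (hg : g ≠ 0) {x y b : ℂ}
    (hb : b ∈ g.roots) (hba : ∀ a ∈ f.roots, ‖y - b‖ ≤ ‖x - a‖) :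
    ‖(complexResultantProduct f g).eval (x * y)‖ ≤
      ((1 + ‖x‖) * (1 + ‖y‖)) ^ (f.natDegree * g.natDegree) *
        (‖f.eval x‖ * rootSize f ^ (g.natDegree - 1) * rootSize g ^ f.natDegree) := by
  classical
  obtain ⟨t, ht⟩ := Multiset.exists_cons_of_mem hb
  set T := (1 + ‖x‖) * (1 + ‖y‖) with hT
  have hm : Multiset.card f.roots = f.natDegree :=
    ((IsAlgClosed.splits f).natDegree_eq_card_roots).symm
  have hn : g.natDegree = Multiset.card t + 1 := by
    rw [(IsAlgClosed.splits g).natDegree_eq_card_roots, ht, Multiset.card_cons]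
  have h1 : (f.roots.map fun a => ‖x * y - a * b‖).prod ≤
      (f.roots.map fun a => ‖x - a‖ * (T * (1 + ‖b‖))).prod := by
    refine Multiset.prod_map_le_prod_map₀ _ _ (fun _ _ => norm_nonneg _) fun a ha => ?_
    have e : x * y - a * b = (x - a) * b + x * (y - b) := by ring
    calc ‖x * y - a * b‖ ≤ ‖x - a‖ * ‖b‖ + ‖x‖ * ‖y - b‖ := by
          rw [e, ← norm_mul, ← norm_mul]; exact norm_add_le _ _
      _ ≤ ‖x - a‖ * ‖b‖ + ‖x‖ * ‖x - a‖ := by gcongr; exact hba a ha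
      _ = ‖x - a‖ * (‖b‖ + ‖x‖) := by ring
      _ ≤ _ := by
          refine mul_le_mul_of_nonneg_left ?_ (norm_nonneg _)
          rw [hT]
          have := mul_nonneg (norm_nonneg x) (norm_nonneg b)
          have := mul_nonneg (norm_nonneg x) (norm_nonneg y)
          have := mul_nonneg (mul_nonneg (norm_nonneg x) (norm_nonneg y)) (norm_nonneg b)
          have := mul_nonneg (norm_nonneg y) (norm_nonneg b)
          have := norm_nonneg y
          nlinarith
  have h2 : ∀ c : ℂ, (f.roots.map fun a => ‖x * y - a * c‖).prod ≤
      (f.roots.map fun a => (1 + ‖a‖) * (T * (1 + ‖c‖))).prod := by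
    intro c
    refine Multiset.prod_map_le_prod_map₀ _ _ (fun _ _ => norm_nonneg _) fun a _ => ?_
    have hxy : ‖x‖ * ‖y‖ ≤ T := by rw [hT]; nlinarith [norm_nonneg x, norm_nonneg y]
    have hT1 : 1 ≤ T := by
      rw [hT]; nlinarith [norm_nonneg x, norm_nonneg y, mul_nonneg (norm_nonneg x) (norm_nonneg y)]
    calc ‖x * y - a * c‖ ≤ ‖x‖ * ‖y‖ + ‖a‖ * ‖c‖ := by
          rw [← norm_mul, ← norm_mul]; exact norm_sub_le _ _
      _ ≤ T * 1 + T * (‖a‖ * ‖c‖) := by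
          nlinarith [mul_nonneg (norm_nonneg a) (norm_nonneg c)]
      _ ≤ T * ((1 + ‖a‖) * (1 + ‖c‖)) := by
          rw [← mul_add]
          refine mul_le_mul_of_nonneg_left ?_ (by linarith)
          nlinarith [norm_nonneg a, norm_nonneg c]
      _ = _ := by ring
  have hP : ∀ c, 0 ≤ (f.roots.map fun a => ‖x * y - a * c‖).prod := by
    intro c
    refine Multiset.prod_nonneg fun r hr => ?_
    obtain ⟨a, -, rfl⟩ := Multiset.mem_map.1 hr
    exact norm_nonneg _
  have h3 : (t.map fun c => (f.roots.map fun a => ‖x * y - a * c‖).prod).prod ≤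
      (t.map fun c => (f.roots.map fun a => (1 + ‖a‖) * (T * (1 + ‖c‖))).prod).prod := by
    exact Multiset.prod_map_le_prod_map₀ _ _ (fun c _ => hP c) fun c _ => h2 c
  have h4 : (g.roots.map fun b => (f.roots.map fun a => ‖x * y - a * b‖).prod).prod ≤
      T ^ (f.natDegree * g.natDegree) * ((f.roots.map fun a => ‖x - a‖).prod *
        (f.roots.map fun a => 1 + ‖a‖).prod ^ (Multiset.card t) *
        (g.roots.map fun b => 1 + ‖b‖).prod ^ f.natDegree) := by
    simp only [ht, Multiset.map_cons, Multiset.prod_cons]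
    refine (mul_le_mul h1 h3 (Multiset.prod_nonneg ?_) ((hP b).trans h1)).trans_eq ?_
    · intro r hr
      obtain ⟨c, -, rfl⟩ := Multiset.mem_map.1 hr
      exact hP c
    · simp only [Multiset.prod_map_mul, Multiset.map_const', Multiset.prod_replicate, hm,
        Multiset.prod_map_pow, hn, mul_pow]
      ring
  rw [norm_eval_complexResultantProduct hf hg, norm_eval_eq f, rootSize, rootSize]
  refine (mul_le_mul_of_nonneg_left h4 (by positivity)).trans_eq ?_
  rw [hn, Nat.add_sub_cancel]
  ring

/-- The value of the resultant product at `x y` is small if both `f(x)` and `g(y)` are. The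
exponents `n - 1` and `m - 1` are what makes linear factors special. -/
theorem norm_eval_complexResultantProduct_le_or {f g : ℂ[X]} (hf : f.natDegree ≠ 0)
    (hg : g.natDegree ≠ 0) (x y : ℂ) :
    ‖(complexResultantProduct f g).eval (x * y)‖ ≤
      ((1 + ‖x‖) * (1 + ‖y‖)) ^ (f.natDegree * g.natDegree) *
        (‖f.eval x‖ * rootSize f ^ (g.natDegree - 1) * rootSize g ^ f.natDegree) ∨
    ‖(complexResultantProduct f g).eval (x * y)‖ ≤
      ((1 + ‖x‖) * (1 + ‖y‖)) ^ (f.natDegree * g.natDegree) *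
        (‖g.eval y‖ * rootSize f ^ g.natDegree * rootSize g ^ (f.natDegree - 1)) := by
  classical
  have hne : ∀ p : ℂ[X], p.natDegree ≠ 0 → ∀ z : ℂ,
      ∃ a ∈ p.roots, ∀ a' ∈ p.roots, ‖z - a‖ ≤ ‖z - a'‖ := by
    intro p hp z
    have h0 : p.roots ≠ 0 := by
      rw [Ne, ← Multiset.card_eq_zero, ← (IsAlgClosed.splits p).natDegree_eq_card_roots]
      exact hp
    obtain ⟨a, ha, h⟩ := p.roots.toFinset.exists_min_image (fun a => ‖z - a‖)
      (Multiset.toFinset_nonempty.2 h0)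
    exact ⟨a, Multiset.mem_toFinset.1 ha, fun a' ha' => h a' (Multiset.mem_toFinset.2 ha')⟩
  have hf0 : f ≠ 0 := fun h => hf (by simp [h])
  have hg0 : g ≠ 0 := fun h => hg (by simp [h])
  obtain ⟨a, ha, hamin⟩ := hne f hf x
  obtain ⟨b, hb, hbmin⟩ := hne g hg y
  rcases le_total ‖y - b‖ ‖x - a‖ with h | h
  · exact Or.inl (norm_eval_complexResultantProduct_le hf0 hg0 hb fun a' ha' =>
      h.trans (hamin a' ha'))
  · right
    have := norm_eval_complexResultantProduct_le hg0 hf0 ha fun b' hb' => h.trans (hbmin b' hb')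
    rw [complexResultantProduct_comm, mul_comm x y]
    refine this.trans_eq ?_
    rw [mul_comm g.natDegree]
    ring

theorem ne_zero_of_int_map {f : ℤ[X]} (hf : f ≠ 0) : f.map (Int.castRingHom ℂ) ≠ 0 :=
  (map_ne_zero_iff (mapRingHom (Int.castRingHom ℂ)) int_map_injective).2 hf

theorem norm_eval_int_map (f : ℤ[X]) (x : ℝ) :
    ‖(f.map (Int.castRingHom ℂ)).eval (x : ℂ)‖ = |aeval x f| := by
  rw [← Real.norm_eq_abs, ← Complex.norm_real]
  congr 1
  rw [eval_map, ← Complex.ofRealHom_eq_coe, ← Complex.ofRealHom_eq_coe, aeval_def, hom_eval₂]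
  congr 1

theorem supNorm_resultantProduct_le {f g : ℤ[X]} (hf : f ≠ 0) (hg : g ≠ 0) :
    (resultantProduct f g).supNorm ≤
      (4 ^ f.natDegree * f.supNorm) ^ g.natDegree *
        (4 ^ g.natDegree * g.supNorm) ^ f.natDegree := by
  have hd : ∀ p : ℤ[X], (p.map (Int.castRingHom ℂ)).natDegree = p.natDegree := fun p =>
    natDegree_map_eq_of_injective Int.cast_injective p
  obtain ⟨k, hk⟩ := (resultantProduct f g).exists_eq_supNorm
  have h := norm_coeff_complexResultantProduct_le (ne_zero_of_int_map hf) (ne_zero_of_int_map hg) k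
  rw [← map_resultantProduct, coeff_map, hd, hd] at h
  rw [hk]
  calc ‖(resultantProduct f g).coeff k‖ =
        ‖(Int.castRingHom ℂ) ((resultantProduct f g).coeff k)‖ := by simp [Int.norm_eq_abs]
    _ ≤ _ := h
    _ ≤ _ := by
        have hF := rootSize_map_le f
        have hG := rootSize_map_le g
        have hF0 := rootSize_nonneg (f.map (Int.castRingHom ℂ))
        have hG0 := rootSize_nonneg (g.map (Int.castRingHom ℂ))
        have hf0 := f.supNorm_nonneg
        gcongr

theorem abs_aeval_resultantProduct_le_or {f g : ℤ[X]} (hf : f.natDegree ≠ 0)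
    (hg : g.natDegree ≠ 0) (x y : ℝ) :
    |aeval (x * y) (resultantProduct f g)| ≤
      ((1 + |x|) * (1 + |y|)) ^ (f.natDegree * g.natDegree) *
        (|aeval x f| * (4 ^ f.natDegree * f.supNorm) ^ (g.natDegree - 1) *
          (4 ^ g.natDegree * g.supNorm) ^ f.natDegree) ∨
    |aeval (x * y) (resultantProduct f g)| ≤
      ((1 + |x|) * (1 + |y|)) ^ (f.natDegree * g.natDegree) *
        (|aeval y g| * (4 ^ f.natDegree * f.supNorm) ^ g.natDegree *
          (4 ^ g.natDegree * g.supNorm) ^ (f.natDegree - 1)) := by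
  have hd : ∀ p : ℤ[X], (p.map (Int.castRingHom ℂ)).natDegree = p.natDegree := fun p =>
    natDegree_map_eq_of_injective Int.cast_injective p
  have h := norm_eval_complexResultantProduct_le_or (f := f.map (Int.castRingHom ℂ))
    (g := g.map (Int.castRingHom ℂ)) (by rwa [hd]) (by rwa [hd]) x y
  rw [← map_resultantProduct, ← Complex.ofReal_mul, norm_eval_int_map, norm_eval_int_map,
    norm_eval_int_map, hd, hd, Complex.norm_real, Complex.norm_real, Real.norm_eq_abs,
    Real.norm_eq_abs] at h
  have hF := rootSize_map_le f
  have hG := rootSize_map_le g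
  have hF0 := rootSize_nonneg (f.map (Int.castRingHom ℂ))
  have hG0 := rootSize_nonneg (g.map (Int.castRingHom ℂ))
  have hf0 := f.supNorm_nonneg
  refine h.imp (fun h => h.trans ?_) (fun h => h.trans ?_) <;> gcongr

/-! ### Infinitesimals and domination -/

section Infinitesimals

variable {U : Ultrafilter ℕ}

theorem IsInfinitesimal.of_abs_le {x y : UPow U ℝ} (hy : IsInfinitesimal y) (h : |x| ≤ |y|) :
    IsInfinitesimal x := fun M hM => h.trans_lt (hy M hM)

theorem isInfinitesimal_zero : IsInfinitesimal (0 : UPow U ℝ) := fun M hM => by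
  rw [abs_zero]; exact Germ.const_lt hM

theorem IsInfinitesimal.abs_lt_one {x : UPow U ℝ} (hx : IsInfinitesimal x) : |x| < 1 :=
  hx 1 one_pos

theorem IsInfinitesimal.const_mul {x : UPow U ℝ} (hx : IsInfinitesimal x) (c : ℝ) :
    IsInfinitesimal ((c : UPow U ℝ) * x) := by
  intro M hM
  have hc : 0 < |c| + 1 := by positivity
  have h1 : |(c : UPow U ℝ)| < ((|c| + 1 : ℝ) : UPow U ℝ) := by
    rw [← Germ.const_abs]; exact Germ.const_lt (lt_add_one _)
  have h2 := hx (M / (|c| + 1)) (div_pos hM hc)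
  have h3 : ((M : ℝ) : UPow U ℝ) =
      ((|c| + 1 : ℝ) : UPow U ℝ) * ((M / (|c| + 1) : ℝ) : UPow U ℝ) := by
    change _ = ((((|c| + 1) * (M / (|c| + 1)) : ℝ)) : UPow U ℝ)
    rw [mul_div_cancel₀ _ hc.ne']
  rw [abs_mul, h3]
  exact mul_lt_mul'' h1 h2 (abs_nonneg _) (abs_nonneg _)

theorem IsInfinitesimal.of_pow {x : UPow U ℝ} {n : ℕ} (h : IsInfinitesimal (x ^ n)) :
    IsInfinitesimal x := by
  intro M hM
  by_contra hx
  have h1 := h (M ^ n) (pow_pos hM n)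
  rw [abs_pow, Germ.const_pow] at h1
  exact absurd (pow_le_pow_left₀ (Germ.const_lt hM).le (not_lt.1 hx) n) (not_le.2 h1)

/-- `y` decays faster than every standard power of `c⁻¹`. It is used for `0 ≤ y` infinitesimal and
`1 ≤ c`; on the level of `-log y` and `log c` it says that `log c = o(-log y)`. -/
def DecaysFasterThanPowers (y c : UPow U ℝ) : Prop := ∀ k : ℕ, y * c ^ k ≤ 1

namespace DecaysFasterThanPowers

theorem of_pow_le {x y c : UPow U ℝ} {n : ℕ} (hn : n ≠ 0) (hx : 0 ≤ x) (hc : 0 ≤ c)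
    (h : DecaysFasterThanPowers y c) (hxy : x ^ n ≤ y) : DecaysFasterThanPowers x c := by
  intro k
  refine (pow_le_one_iff_of_nonneg (mul_nonneg hx (pow_nonneg hc k)) hn).1 ?_
  rw [mul_pow, ← pow_mul]
  exact (mul_le_mul_of_nonneg_right hxy (pow_nonneg hc _)).trans (h _)

theorem mul {y c c' : UPow U ℝ} (hy : 0 ≤ y) (hc : 0 ≤ c) (hc' : 0 ≤ c')
    (h : DecaysFasterThanPowers y c) (h' : DecaysFasterThanPowers y c') :
    DecaysFasterThanPowers y (c * c') := by
  intro k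
  refine (pow_le_one_iff_of_nonneg (mul_nonneg hy (pow_nonneg (mul_nonneg hc hc') k))
    two_ne_zero).1 ?_
  calc (y * (c * c') ^ k) ^ 2 = (y * c ^ (k * 2)) * (y * c' ^ (k * 2)) := by ring
    _ ≤ 1 := mul_le_one₀ (h _) (mul_nonneg hy (pow_nonneg hc' _)) (h' _)

theorem const {y : UPow U ℝ} (hy : IsInfinitesimal y) (c : ℝ) :
    DecaysFasterThanPowers y (c : UPow U ℝ) := by
  intro k
  rw [← Germ.const_pow, mul_comm]
  exact (le_abs_self _).trans ((hy.const_mul (c ^ k)).abs_lt_one).le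

theorem mono {y c c' : UPow U ℝ} (hy : 0 ≤ y) (hc : 0 ≤ c) (h : DecaysFasterThanPowers y c')
    (hcc' : c ≤ c') : DecaysFasterThanPowers y c := fun k =>
  (mul_le_mul_of_nonneg_left (pow_le_pow_left₀ hc hcc' k) hy).trans (h k)

theorem isInfinitesimal_mul {y c : UPow U ℝ} (hy : 0 ≤ y) (hyi : IsInfinitesimal y)
    (h : DecaysFasterThanPowers y c) : IsInfinitesimal (y * c) := by
  refine IsInfinitesimal.of_pow (n := 2) (hyi.of_abs_le ?_)
  rw [abs_of_nonneg (sq_nonneg _), abs_of_nonneg hy]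
  calc (y * c) ^ 2 = y * (y * c ^ 2) := by ring
    _ ≤ y * 1 := mul_le_mul_of_nonneg_left (h 2) hy
    _ = y := mul_one y

end DecaysFasterThanPowers

end Infinitesimals

/-! ### The order of the Frobenius growth-decay semiring -/

section FrobeniusOrder

variable {U : Ultrafilter ℕ}

theorem starPow_natCast (x : UPow U ℝ) (k : ℕ) : starPow x (k : UPow U ℝ) = x ^ k := by
  induction x using Germ.inductionOn with
  | _ x => exact Germ.coe_eq.2 (Eventually.of_forall fun i => Real.rpow_natCast _ _)

theorem starPow_le_starPow_of_exponent_ge {x r s : UPow U ℝ} (hx : 0 ≤ x) (hx1 : x ≤ 1)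
    (hs : 0 < s) (h : s ≤ r) : starPow x r ≤ starPow x s := by
  induction x, r, s using Germ.inductionOn₃ with
  | _ x r s =>
    have hx' : ∀ᶠ i in (U : Filter ℕ), 0 ≤ x i := hx
    have hx1' : ∀ᶠ i in (U : Filter ℕ), x i ≤ 1 := hx1
    have hs' : ∀ᶠ i in (U : Filter ℕ), 0 < s i := Germ.coe_lt.1 hs
    have h' : ∀ᶠ i in (U : Filter ℕ), s i ≤ r i := h
    exact ((hx'.and hx1').and (hs'.and h')).mono fun i hi =>
      Real.rpow_le_rpow_of_exponent_ge_of_imp hi.1.1 hi.1.2 hi.2.2 fun _ h0 =>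
        absurd h0 (hi.2.1.trans_le hi.2.2).ne'

theorem IsPosUnit.exists_nat_bounds {u : UPow U ℝ} (hu : IsPosUnit u) :
    ∃ n : ℕ, n ≠ 0 ∧ u ≤ n ∧ 1 ≤ u * n := by
  obtain ⟨m, M, hm, h1, h2⟩ := hu
  obtain ⟨n, hn⟩ := exists_nat_ge (max (max M m⁻¹) 1)
  simp only [max_le_iff] at hn
  have hn0 : (0 : ℝ) < n := one_pos.trans_le hn.2
  refine ⟨n, by exact_mod_cast hn0.ne', h2.trans (Germ.const_le hn.1.1), ?_⟩
  have h3 : (1 : UPow U ℝ) ≤ (m : UPow U ℝ) * ((n : ℝ) : UPow U ℝ) := by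
    refine Germ.const_le (x := (1 : ℝ)) (y := m * n) ?_
    rw [← mul_inv_cancel₀ hm.ne']
    exact mul_le_mul_of_nonneg_left hn.1.2 hm.le
  exact h3.trans (mul_le_mul_of_nonneg_right h1 (Germ.const_le hn0.le))

theorem isPosUnit_natCast {n : ℕ} (hn : n ≠ 0) : IsPosUnit (n : UPow U ℝ) :=
  ⟨n, n, by positivity, le_refl _, le_refl _⟩

theorem GrowthDecay.mk_eq_mk {x y : {x : UPow U ℝ // 0 ≤ x}} :
    GrowthDecay.mk x = GrowthDecay.mk y ↔ ∃ u, IsPosUnit u ∧ y.1 = u * x.1 :=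
  Quotient.eq (r := growthDecaySetoid U)

theorem FrobGrowthDecay.mk_eq_mk {μ ν : GrowthDecay U} :
    FrobGrowthDecay.mk μ = FrobGrowthDecay.mk ν ↔ ∃ r, ν = GrowthDecay.frobenius r μ :=
  Quotient.eq (r := frobeniusSetoid U)

/-- The representatives of a Frobenius class are obtained from one of them by a power and a
factor. -/
theorem mk_mk_eq_frobClass_iff {x : {x : UPow U ℝ // 0 ≤ x}} {y : UPow U ℝ} :
    FrobGrowthDecay.mk (GrowthDecay.mk x) = frobClass y ↔
      ∃ r u, IsPosUnit r ∧ IsPosUnit u ∧ x.1 = u * starPow |y| r := by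
  rw [eq_comm, frobClass, FrobGrowthDecay.mk_eq_mk]
  constructor
  · rintro ⟨r, hr⟩
    obtain ⟨u, hu, h⟩ := GrowthDecay.mk_eq_mk.1 hr.symm
    exact ⟨r.1, u, r.2, hu, h⟩
  · rintro ⟨r, u, hr, hu, h⟩
    exact ⟨⟨r, hr⟩, (GrowthDecay.mk_eq_mk.2 ⟨u, hu, h⟩).symm⟩

theorem frobClass_lt_iff {a b : UPow U ℝ} : frobClass a < frobClass b ↔
    ∀ r u s v, IsPosUnit r → IsPosUnit u → IsPosUnit s → IsPosUnit v →
      u * starPow |a| r < v * starPow |b| s := by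
  constructor
  · intro h r u s v hr hu hs hv
    exact h _ _ (mk_mk_eq_frobClass_iff.2 ⟨r, u, hr, hu, rfl⟩)
      (mk_mk_eq_frobClass_iff.2 ⟨s, v, hs, hv, rfl⟩)
      ⟨u * starPow |a| r, mul_nonneg hu.pos.le (starPow_nonneg (abs_nonneg _) _)⟩
      ⟨v * starPow |b| s, mul_nonneg hv.pos.le (starPow_nonneg (abs_nonneg _) _)⟩ rfl rfl
  · rintro h _ _ hx hy x y rfl rfl
    obtain ⟨r, u, hr, hu, hx⟩ := mk_mk_eq_frobClass_iff.1 hx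
    obtain ⟨s, v, hs, hv, hy⟩ := mk_mk_eq_frobClass_iff.1 hy
    rw [hx, hy]
    exact h r u s v hr hu hs hv

/-- The strict order between the class of an infinitesimal and a class of the form `[c⁻¹]`, `c ≥ 1`,
such as a growth class of a polynomial, is domination of all standard powers. -/
theorem frobClass_lt_inv_iff {y c : UPow U ℝ} (hy : IsInfinitesimal y) (hc : 1 ≤ c) :
    frobClass y < frobClass c⁻¹ ↔ DecaysFasterThanPowers |y| c := by
  have hc0 : 0 < c := one_pos.trans_le hc
  rw [frobClass_lt_iff, abs_of_pos (inv_pos.2 hc0)]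
  constructor
  · intro h k
    rcases eq_or_ne k 0 with rfl | hk
    · rw [pow_zero, mul_one]; exact hy.abs_lt_one.le
    have := h 1 1 k 1 isPosUnit_one isPosUnit_one (isPosUnit_natCast hk) isPosUnit_one
    rw [one_mul, one_mul, starPow_one, starPow_natCast, inv_pow, ← one_div,
      lt_div_iff₀ (pow_pos hc0 k)] at this
    exact this.le
  · intro h r u s v hr hu hs hv
    obtain ⟨R, hR0, -, hR⟩ := hr.exists_nat_bounds
    obtain ⟨M, hM0, hM, -⟩ := hu.exists_nat_bounds
    obtain ⟨S, hS0, hS, -⟩ := hs.exists_nat_bounds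
    obtain ⟨V, hV0, -, hV⟩ := hv.exists_nat_bounds
    -- a fixed power of `p = |y| ^ r` is at most `|y|`
    set p := starPow |y| r with hp
    have hp0 : 0 ≤ p := starPow_nonneg (abs_nonneg _) _
    have hpR : p ^ R ≤ |y| := by
      rw [hp, ← starPow_natCast, ← starPow_mul (abs_nonneg _)]
      refine (starPow_le_starPow_of_exponent_ge (abs_nonneg _) hy.abs_lt_one.le one_pos hR).trans ?_
      rw [starPow_one]
    have hpi : IsInfinitesimal p := by
      refine IsInfinitesimal.of_pow (n := R) (hy.of_abs_le ?_)
      rwa [abs_of_nonneg (pow_nonneg hp0 R)]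
    have hpc : DecaysFasterThanPowers p ((M * V : ℝ) * c ^ S) := by
      refine .mul hp0 (Germ.const_le (by positivity)) (pow_nonneg hc0.le S)
        (.const hpi _) fun k => ?_
      rw [← pow_mul]
      exact h.of_pow_le hR0 hp0 hc0.le hpR _
    have h1 := (hpc.isInfinitesimal_mul hp0 hpi).abs_lt_one
    have h2 : p * ((M : UPow U ℝ) * V * c ^ S) < 1 := (le_abs_self _).trans_lt h1
    have h3 : (c⁻¹) ^ S ≤ starPow c⁻¹ s := by
      rw [← starPow_natCast]
      exact starPow_le_starPow_of_exponent_ge (inv_pos.2 hc0).le (inv_le_one_of_one_le₀ hc) hs.pos hS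
    have hVpos : (0 : UPow U ℝ) < V := (isPosUnit_natCast hV0).pos
    have hcS := pow_pos hc0 S
    have hv0 := hv.pos
    calc u * p ≤ M * p := mul_le_mul_of_nonneg_right hM hp0
      _ < v * (c⁻¹) ^ S := by
        rw [inv_pow, ← div_eq_mul_inv, lt_div_iff₀ hcS]
        refine lt_of_mul_lt_mul_right ?_ hVpos.le
        calc (M : UPow U ℝ) * p * c ^ S * V = p * ((M : UPow U ℝ) * V * c ^ S) := by ring
          _ < 1 := h2
          _ ≤ v * V := hV
      _ ≤ v * starPow c⁻¹ s := mul_le_mul_of_nonneg_left h3 hv0.le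

/-- Below the class of an infinitesimal, the order of Frobenius classes is the order of
representatives up to a standard power. -/
theorem exists_pow_le_of_frobClass_le {a b : UPow U ℝ} (hb : IsInfinitesimal b)
    (h : frobClass a ≤ frobClass b) : ∃ n : ℕ, n ≠ 0 ∧ |a| ^ n ≤ |b| := by
  rcases h with h | h
  · have := frobClass_lt_iff.1 h 1 1 1 1 isPosUnit_one isPosUnit_one isPosUnit_one isPosUnit_one
    rw [one_mul, one_mul, starPow_one, starPow_one] at this
    exact ⟨1, one_ne_zero, by rw [pow_one]; exact this.le⟩
  · obtain ⟨r, u, hr, hu, h⟩ := mk_mk_eq_frobClass_iff.1 h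
    obtain ⟨R, hR0, -, hR⟩ := hr.exists_nat_bounds
    obtain ⟨M, hM0, hM, -⟩ := hu.exists_nat_bounds
    -- `|a| = u p` with `p = |b| ^ r` and `p ^ R ≤ |b|`; squaring absorbs `u`, as `p` is infinitesimal
    set p := starPow |b| r with hp
    have hp0 : 0 ≤ p := starPow_nonneg (abs_nonneg _) _
    have hpR : p ^ R ≤ |b| := by
      rw [hp, ← starPow_natCast, ← starPow_mul (abs_nonneg _)]
      refine (starPow_le_starPow_of_exponent_ge (abs_nonneg _) hb.abs_lt_one.le one_pos hR).trans ?_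
      rw [starPow_one]
    have hpi : IsInfinitesimal p := by
      refine IsInfinitesimal.of_pow (n := R) (hb.of_abs_le ?_)
      rwa [abs_of_nonneg (pow_nonneg hp0 R)]
    have hMp : (M : UPow U ℝ) ^ 2 * p ≤ 1 :=
      (le_abs_self _).trans (hpi.const_mul ((M : ℝ) ^ 2)).abs_lt_one.le
    refine ⟨2 * R, by positivity, le_trans ?_ hpR⟩
    rw [pow_mul]
    refine pow_le_pow_left₀ (sq_nonneg _) ?_ R
    change |a| = u * p at h
    rw [h]
    calc (u * p) ^ 2 ≤ (M * p) ^ 2 :=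
          pow_le_pow_left₀ (mul_nonneg hu.pos.le hp0) (mul_le_mul_of_nonneg_right hM hp0) 2
      _ = (M ^ 2 * p) * p := by ring
      _ ≤ 1 * p := mul_le_mul_of_nonneg_right hMp hp0
      _ = p := one_mul p

theorem frobClass_starPow {x r : UPow U ℝ} (hx : 0 ≤ x) (hr : IsPosUnit r) :
    frobClass (starPow x r) = frobClass x := by
  refine mk_mk_eq_frobClass_iff.2 ⟨r, 1, hr, isPosUnit_one, ?_⟩
  simp only [one_mul, abs_of_nonneg hx, abs_of_nonneg (starPow_nonneg hx r)]

end FrobeniusOrder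

/-! ### Bounds in terms of normalized heights and values -/

/-- Nonzero integer polynomials have height at least `1`, so that their growth classes are classes
of inverses of numbers `≥ 1`. -/
theorem one_le_supNorm {f : ℤ[X]} (hf : f ≠ 0) : 1 ≤ f.supNorm := by
  refine le_trans ?_ (f.le_supNorm f.natDegree)
  rw [Int.norm_eq_abs]
  exact_mod_cast Int.one_le_abs (leadingCoeff_ne_zero.2 hf)

/-- The degrees `m` and `n` may be replaced by upper bounds `d` and `e` if the height `h` is written
as `A ^ d`, with `A = h ^ (1 / d)`. -/
theorem four_pow_mul_pow_le {A : ℝ} (hA : 1 ≤ A) {m n d e : ℕ} (hm : m ≤ d) (hn : n ≤ e) :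
    (4 ^ m * A ^ d) ^ n ≤ (4 * A) ^ (d * e) := by
  have h4 : (4 : ℝ) ^ (m * n) ≤ 4 ^ (d * e) :=
    pow_le_pow_right₀ (by norm_num) (Nat.mul_le_mul hm hn)
  have hA' : A ^ (d * n) ≤ A ^ (d * e) := pow_le_pow_right₀ hA (Nat.mul_le_mul le_rfl hn)
  rw [mul_pow, mul_pow, ← pow_mul, ← pow_mul]
  gcongr

theorem supNorm_resultantProduct_le_pow {f g : ℤ[X]} (hf : f ≠ 0) (hg : g ≠ 0) {d e : ℕ}
    (hd : f.natDegree ≤ d) (he : g.natDegree ≤ e) {A B : ℝ} (hA : 1 ≤ A) (hB : 1 ≤ B)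
    (hAd : A ^ d = f.supNorm) (hBe : B ^ e = g.supNorm) :
    (resultantProduct f g).supNorm ≤ (16 * (A * B)) ^ (d * e) := by
  have h1 := four_pow_mul_pow_le hA hd he
  have h2 := four_pow_mul_pow_le hB he hd
  refine (supNorm_resultantProduct_le hf hg).trans ?_
  rw [← hAd, ← hBe]
  calc _ ≤ (4 * A) ^ (d * e) * (4 * B) ^ (e * d) := by gcongr
    _ = _ := by rw [mul_comm e d, ← mul_pow]; ring

/-- In terms of `A = h(f) ^ (1 / d)`, `B = h(g) ^ (1 / e)`, `F = |f(x)| ^ (1 / (d e))` and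
`G = |g(y)| ^ (1 / (d e))`, the value of the resultant product at `x y` is, up to constants, at most
the power with exponent `d e` of `F A B` or of `G A B`. If `d = 1`, then the factor `B` of
`G A B` may be omitted. -/
theorem abs_aeval_resultantProduct_le_pow {f g : ℤ[X]} (hf : f.natDegree ≠ 0)
    (hg : g.natDegree ≠ 0) {d e : ℕ} (hd : f.natDegree ≤ d) (he : g.natDegree ≤ e)
    {A B B' F G x y : ℝ} (hA : 1 ≤ A) (hB : 1 ≤ B) (hAd : A ^ d = f.supNorm)
    (hBe : B ^ e = g.supNorm) (hF : F ^ (d * e) = |aeval x f|) (hG : G ^ (d * e) = |aeval y g|)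
    (hB' : B' = B ∨ d = 1 ∧ B' = 1) :
    |aeval (x * y) (resultantProduct f g)| ≤
      (16 * ((1 + |x|) * (1 + |y|)) * (F * (A * B))) ^ (d * e) ∨
    |aeval (x * y) (resultantProduct f g)| ≤
      (16 * ((1 + |x|) * (1 + |y|)) * (G * (A * B'))) ^ (d * e) := by
  set T := (1 + |x|) * (1 + |y|) with hT
  have hT1 : 1 ≤ T := one_le_mul_of_one_le_of_one_le (by linarith [abs_nonneg x])
    (by linarith [abs_nonneg y])
  have hTp : T ^ (f.natDegree * g.natDegree) ≤ T ^ (d * e) :=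
    pow_le_pow_right₀ hT1 (Nat.mul_le_mul hd he)
  have hA1 := four_pow_mul_pow_le hA hd he
  have hA2 := four_pow_mul_pow_le hA hd ((Nat.sub_le _ 1).trans he)
  have hB1 := four_pow_mul_pow_le hB he hd
  have hB2 : (4 ^ g.natDegree * B ^ e) ^ (f.natDegree - 1) ≤ (4 * B') ^ (e * d) := by
    rcases hB' with rfl | ⟨rfl, rfl⟩
    · exact four_pow_mul_pow_le hB he ((Nat.sub_le _ 1).trans hd)
    · rw [show f.natDegree - 1 = 0 by omega, pow_zero]
      exact one_le_pow₀ (by norm_num)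
  have hB'0 : 0 ≤ B' := by rcases hB' with rfl | ⟨-, rfl⟩ <;> linarith
  refine (abs_aeval_resultantProduct_le_or hf hg x y).imp (fun h => h.trans ?_)
    (fun h => h.trans ?_)
  · rw [← hAd, ← hBe, ← hF]
    have hF0 : 0 ≤ F ^ (d * e) := hF ▸ abs_nonneg _
    calc _ ≤ T ^ (d * e) * (F ^ (d * e) * (4 * A) ^ (d * e) * (4 * B) ^ (e * d)) := by gcongr
      _ = _ := by rw [mul_comm e d, ← mul_pow, ← mul_pow, ← mul_pow]; ring
  · rw [← hAd, ← hBe, ← hG]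
    have hG0 : 0 ≤ G ^ (d * e) := hG ▸ abs_nonneg _
    calc _ ≤ T ^ (d * e) * (G ^ (d * e) * (4 * A) ^ (d * e) * (4 * B') ^ (e * d)) := by gcongr
      _ = _ := by rw [mul_comm e d, ← mul_pow, ← mul_pow, ← mul_pow]; ring

section Ultrapower

variable {U : Ultrafilter ℕ}

theorem starResultantProduct_comm (f g : UPow U ℤ[X]) : f ⊠ g = g ⊠ f := by
  induction f, g using Germ.inductionOn₂ with
  | _ f g => exact Germ.coe_eq.2 (Eventually.of_forall fun i => resultantProduct_comm _ _)

theorem starResultantProduct_zero_left (g : UPow U ℤ[X]) : 0 ⊠ g = 0 := by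
  induction g using Germ.inductionOn with
  | _ g => exact Germ.coe_eq.2 (Eventually.of_forall fun i => resultantProduct_zero_left _)

theorem germ_ne_zero_iff {α : Type} [Zero α] {f : ℕ → α} :
    (f : UPow U α) ≠ 0 ↔ ∀ᶠ i in (U : Filter ℕ), f i ≠ 0 := by
  rw [Ultrafilter.eventually_not]
  exact not_congr Germ.coe_eq

theorem starResultantProduct_ne_zero {f g : UPow U ℤ[X]} (hf : f ≠ 0) (hg : g ≠ 0) :
    f ⊠ g ≠ 0 := by
  induction f, g using Germ.inductionOn₂ with
  | _ f g =>
    exact germ_ne_zero_iff.2 (((germ_ne_zero_iff.1 hf).and (germ_ne_zero_iff.1 hg)).mono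
      fun i hi => resultantProduct_ne_zero hi.1 hi.2)

/-- The normalized height `h(f) ^ (1 / d)`; `growth d f` is by definition the class of its
inverse. -/
noncomputable def rootHeight (d : UPow U ℕ) (f : UPow U ℤ[X]) : UPow U ℝ :=
  starPow (starHeight f) (natToReal d)⁻¹

/-- The normalized value `(|f(θ)| ^ (1 / d)) ^ (1 / e)`; `decayRoot θ d e f` is by definition its
class. -/
noncomputable def rootValue (θ : ℝ) (d e : UPow U ℕ) (f : UPow U ℤ[X]) : UPow U ℝ :=
  starPow (starPow |starEval θ f| (natToReal d)⁻¹) (natToReal e)⁻¹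

theorem abs_starEval_coe (θ : ℝ) (f : ℕ → ℤ[X]) :
    |starEval θ (f : UPow U ℤ[X])| = ((fun i => |aeval θ (f i)| : ℕ → ℝ) : UPow U ℝ) := by
  rw [Germ.abs_def]
  rfl

theorem rootValue_nonneg (θ : ℝ) (d e : UPow U ℕ) (f : UPow U ℤ[X]) : 0 ≤ rootValue θ d e f :=
  starPow_nonneg (starPow_nonneg (abs_nonneg _) _) _

theorem one_le_rootHeight (d : UPow U ℕ) {f : UPow U ℤ[X]} (hf : f ≠ 0) : 1 ≤ rootHeight d f := by
  induction d, f using Germ.inductionOn₂ with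
  | _ d f =>
    exact (germ_ne_zero_iff.1 hf).mono fun i hi =>
      Real.one_le_rpow (one_le_supNorm hi) (inv_nonneg.2 (Nat.cast_nonneg _))

/-- Nonzero integer constants are not small, so an approximation has roots. -/
theorem natDegree_ne_zero_of_abs_aeval_lt_one {f : ℤ[X]} (hf : f ≠ 0) {x : ℝ}
    (h : |aeval x f| < 1) : f.natDegree ≠ 0 := by
  intro hd
  rw [eq_C_of_natDegree_eq_zero hd] at h hf
  have h0 : f.coeff 0 ≠ 0 := fun h => hf (by rw [h, C_0])
  rw [aeval_C, eq_intCast] at h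
  have : |f.coeff 0| < 1 := by exact_mod_cast h
  exact absurd (Int.one_le_abs h0) (not_le.2 this)

theorem rootHeight_starResultantProduct_le {d e : UPow U ℕ} (hd : 1 ≤ d) (he : 1 ≤ e)
    {f g : UPow U ℤ[X]} (hf : f ≠ 0) (hg : g ≠ 0) (hfd : starDeg f ≤ d) (hge : starDeg g ≤ e) :
    rootHeight (d * e) (f ⊠ g) ≤ ((16 : ℝ) : UPow U ℝ) * (rootHeight d f * rootHeight e g) := by
  induction d, e using Germ.inductionOn₂ with
  | _ d e =>
  induction f, g using Germ.inductionOn₂ with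
  | _ f g =>
  have hd' : ∀ᶠ i in (U : Filter ℕ), 1 ≤ d i := hd
  have he' : ∀ᶠ i in (U : Filter ℕ), 1 ≤ e i := he
  have hfd' : ∀ᶠ i in (U : Filter ℕ), (f i).natDegree ≤ d i := hfd
  have hge' : ∀ᶠ i in (U : Filter ℕ), (g i).natDegree ≤ e i := hge
  change ∀ᶠ i in (U : Filter ℕ), (resultantProduct (f i) (g i)).supNorm ^ (((d i * e i : ℕ) : ℝ)⁻¹)
    ≤ 16 * ((f i).supNorm ^ ((d i : ℝ)⁻¹) * (g i).supNorm ^ ((e i : ℝ)⁻¹))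
  filter_upwards [hd', he', hfd', hge', germ_ne_zero_iff.1 hf, germ_ne_zero_iff.1 hg]
    with i hdi hei hfi hgi hf0 hg0
  have hd0 : d i ≠ 0 := by omega
  have he0 : e i ≠ 0 := by omega
  have hA := Real.one_le_rpow (one_le_supNorm hf0) (inv_nonneg.2 (Nat.cast_nonneg (d i)))
  have hB := Real.one_le_rpow (one_le_supNorm hg0) (inv_nonneg.2 (Nat.cast_nonneg (e i)))
  have h := supNorm_resultantProduct_le_pow hf0 hg0 hfi hgi hA hB
    (Real.rpow_inv_natCast_pow (f i).supNorm_nonneg hd0)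
    (Real.rpow_inv_natCast_pow (g i).supNorm_nonneg he0)
  refine (Real.rpow_le_rpow (supNorm_nonneg _) h (by positivity)).trans_eq ?_
  exact Real.pow_rpow_inv_natCast (by positivity) (Nat.mul_ne_zero hd0 he0)

theorem isInfinitesimal_starEval_starResultantProduct {d e : UPow U ℕ} (hd : 1 ≤ d) (he : 1 ≤ e)
    {f g : UPow U ℤ[X]} (hf : f ≠ 0) (hg : g ≠ 0) (hfd : starDeg f ≤ d) (hge : starDeg g ≤ e)
    {θ η : ℝ} (hfθ : IsInfinitesimal (starEval θ f)) (hgη : IsInfinitesimal (starEval η g))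
    (hF : IsInfinitesimal (rootValue θ d e f * (rootHeight d f * rootHeight e g)))
    (hG : IsInfinitesimal (rootValue η e d g * (rootHeight d f * rootHeight e g)) ∨
      d = 1 ∧ IsInfinitesimal (rootValue η e d g * (rootHeight d f * 1))) :
    IsInfinitesimal (starEval (θ * η) (f ⊠ g)) := by
  obtain ⟨B', hB', hG⟩ : ∃ B', (B' = rootHeight e g ∨ d = 1 ∧ B' = 1) ∧
      IsInfinitesimal (rootValue η e d g * (rootHeight d f * B')) := by
    rcases hG with hG | ⟨h, hG⟩
    · exact ⟨_, Or.inl rfl, hG⟩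
    · exact ⟨1, Or.inr ⟨h, rfl⟩, hG⟩
  set K : ℝ := 16 * ((1 + |θ|) * (1 + |η|)) with hK
  suffices h : |starEval (θ * η) (f ⊠ g)| ≤
        |(K : UPow U ℝ) * (rootValue θ d e f * (rootHeight d f * rootHeight e g))| ∨
      |starEval (θ * η) (f ⊠ g)| ≤
        |(K : UPow U ℝ) * (rootValue η e d g * (rootHeight d f * B'))| by
    rcases h with h | h
    · exact (hF.const_mul K).of_abs_le h
    · exact (hG.const_mul K).of_abs_le h
  have hF1 := (hF.const_mul K).abs_lt_one
  have hG1 := (hG.const_mul K).abs_lt_one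
  have hfθ := hfθ.abs_lt_one
  have hgη := hgη.abs_lt_one
  induction d, e using Germ.inductionOn₂ with
  | _ d e =>
  induction f, g, B' using Germ.inductionOn₃ with
  | _ f g B' =>
  have hd' : ∀ᶠ i in (U : Filter ℕ), 1 ≤ d i := hd
  have he' : ∀ᶠ i in (U : Filter ℕ), 1 ≤ e i := he
  have hfd' : ∀ᶠ i in (U : Filter ℕ), (f i).natDegree ≤ d i := hfd
  have hge' : ∀ᶠ i in (U : Filter ℕ), (g i).natDegree ≤ e i := hge
  have hB'' : ∀ᶠ i in (U : Filter ℕ), B' i = (g i).supNorm ^ ((e i : ℝ)⁻¹) ∨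
      d i = 1 ∧ B' i = 1 := by
    rcases hB' with h | ⟨h, h'⟩
    · exact (Germ.coe_eq.1 h).mono fun i hi => Or.inl hi
    · exact ((Germ.coe_eq.1 h).and (Germ.coe_eq.1 h')).mono fun i hi => Or.inr hi
  rw [rootValue, abs_starEval_coe, Germ.abs_def] at hF1
  rw [rootValue, abs_starEval_coe, Germ.abs_def] at hG1
  rw [abs_starEval_coe] at hfθ hgη
  rw [rootValue, rootValue, abs_starEval_coe, abs_starEval_coe, Germ.abs_def, Germ.abs_def,
    Germ.abs_def]
  have hF1' : ∀ᶠ i in (U : Filter ℕ), |K * ((|aeval θ (f i)| ^ ((d i : ℝ)⁻¹)) ^ ((e i : ℝ)⁻¹) *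
      ((f i).supNorm ^ ((d i : ℝ)⁻¹) * (g i).supNorm ^ ((e i : ℝ)⁻¹)))| < 1 := Germ.coe_lt.1 hF1
  have hG1' : ∀ᶠ i in (U : Filter ℕ), |K * ((|aeval η (g i)| ^ ((e i : ℝ)⁻¹)) ^ ((d i : ℝ)⁻¹) *
      ((f i).supNorm ^ ((d i : ℝ)⁻¹) * B' i))| < 1 := Germ.coe_lt.1 hG1
  have hfθ' : ∀ᶠ i in (U : Filter ℕ), |aeval θ (f i)| < 1 := Germ.coe_lt.1 hfθ
  have hgη' : ∀ᶠ i in (U : Filter ℕ), |aeval η (g i)| < 1 := Germ.coe_lt.1 hgη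
  change (∀ᶠ i in (U : Filter ℕ), |aeval (θ * η) (resultantProduct (f i) (g i))| ≤
      |K * ((|aeval θ (f i)| ^ ((d i : ℝ)⁻¹)) ^ ((e i : ℝ)⁻¹) *
        ((f i).supNorm ^ ((d i : ℝ)⁻¹) * (g i).supNorm ^ ((e i : ℝ)⁻¹)))|) ∨
    (∀ᶠ i in (U : Filter ℕ), |aeval (θ * η) (resultantProduct (f i) (g i))| ≤
      |K * ((|aeval η (g i)| ^ ((e i : ℝ)⁻¹)) ^ ((d i : ℝ)⁻¹) *
        ((f i).supNorm ^ ((d i : ℝ)⁻¹) * B' i))|)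
  rw [← Ultrafilter.eventually_or]
  filter_upwards [hd', he', hfd', hge', germ_ne_zero_iff.1 hf, germ_ne_zero_iff.1 hg, hB'', hF1',
    hG1', hfθ', hgη'] with i hdi hei hfi hgi hf0 hg0 hBi hFi hGi hθi hηi
  have hd0 : d i ≠ 0 := by omega
  have he0 : e i ≠ 0 := by omega
  have hA := Real.one_le_rpow (one_le_supNorm hf0) (inv_nonneg.2 (Nat.cast_nonneg (d i)))
  have hB := Real.one_le_rpow (one_le_supNorm hg0) (inv_nonneg.2 (Nat.cast_nonneg (e i)))
  have hroot : ∀ (v : ℝ) (m n : ℕ), 0 ≤ v → m ≠ 0 → n ≠ 0 →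
      ((v ^ ((m : ℝ)⁻¹)) ^ ((n : ℝ)⁻¹)) ^ (n * m) = v := by
    intro v m n hv hm hn
    rw [pow_mul, Real.rpow_inv_natCast_pow (Real.rpow_nonneg hv _) hn,
      Real.rpow_inv_natCast_pow hv hm]
  have h := abs_aeval_resultantProduct_le_pow (natDegree_ne_zero_of_abs_aeval_lt_one hf0 hθi)
    (natDegree_ne_zero_of_abs_aeval_lt_one hg0 hηi) hfi hgi hA hB
    (Real.rpow_inv_natCast_pow (f i).supNorm_nonneg hd0)
    (Real.rpow_inv_natCast_pow (g i).supNorm_nonneg he0)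
    ((congrArg _ (mul_comm _ _)).trans (hroot _ _ _ (abs_nonneg (aeval θ (f i))) hd0 he0))
    (hroot _ _ _ (abs_nonneg (aeval η (g i))) he0 hd0) hBi
  -- both bounds are powers of numbers of absolute value below `1`
  have hpow : ∀ c : ℝ, |c| < 1 → c ^ (d i * e i) ≤ |c| := fun c hc =>
    (le_abs_self _).trans (by
      rw [abs_pow]
      exact pow_le_of_le_one (abs_nonneg c) hc.le (Nat.mul_ne_zero hd0 he0))
  exact h.imp (fun h => h.trans (hpow _ hFi)) (fun h => h.trans (hpow _ hGi))

/-- Everything that has to be checked about the factors is a domination between their normalized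
heights, their normalized values and a representative of `ν`. -/
theorem starResultantProduct_mem_approxSet {d e : UPow U ℕ} (hd : 1 ≤ d) (he : 1 ≤ e)
    {f g : UPow U ℤ[X]} (hf : f ≠ 0) (hg : g ≠ 0) (hfd : starDeg f ≤ d) (hge : starDeg g ≤ e)
    {θ η : ℝ} (hfθ : IsInfinitesimal (starEval θ f)) (hgη : IsInfinitesimal (starEval η g))
    {y : UPow U ℝ} (hy : IsInfinitesimal y)
    (hyf : DecaysFasterThanPowers |y| (rootHeight d f))
    (hyg : DecaysFasterThanPowers |y| (rootHeight e g))
    (hF : IsInfinitesimal (rootValue θ d e f * (rootHeight d f * rootHeight e g)))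
    (hG : IsInfinitesimal (rootValue η e d g * (rootHeight d f * rootHeight e g)) ∨
      d = 1 ∧ IsInfinitesimal (rootValue η e d g * (rootHeight d f * 1))) :
    f ⊠ g ∈ approxSet (frobClass y) (θ * η) (d * e) := by
  have hfg := starResultantProduct_ne_zero hf hg
  refine ⟨isInfinitesimal_starEval_starResultantProduct hd he hf hg hfd hge hfθ hgη hF hG, ?_,
    Or.inr ?_⟩
  · induction d, e using Germ.inductionOn₂ with
    | _ d e =>
    induction f, g using Germ.inductionOn₂ with
    | _ f g =>
    have hfd' : ∀ᶠ i in (U : Filter ℕ), (f i).natDegree ≤ d i := hfd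
    have hge' : ∀ᶠ i in (U : Filter ℕ), (g i).natDegree ≤ e i := hge
    exact (hfd'.and hge').mono fun i hi =>
      (natDegree_resultantProduct_le _ _).trans (Nat.mul_le_mul hi.1 hi.2)
  · have hA := zero_le_one.trans (one_le_rootHeight d hf)
    have hB := zero_le_one.trans (one_le_rootHeight e hg)
    have hfg1 := one_le_rootHeight (d * e) hfg
    refine (frobClass_lt_inv_iff hy hfg1).2 (.mono (abs_nonneg _) (zero_le_one.trans hfg1) ?_
      (rootHeight_starResultantProduct_le hd he hf hg hfd hge))
    exact .mul (abs_nonneg _) (Germ.const_le (by norm_num)) (mul_nonneg hA hB)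
      (.const (hy.of_abs_le (abs_abs y).le) 16) (.mul (abs_nonneg _) hA hB hyf hyg)

end Ultrapower

/-! ### Products of approximations -/

section Products

variable {U : Ultrafilter ℕ}

theorem frobClass_surjective : Function.Surjective (frobClass (U := U)) := by
  intro μ
  induction μ using Quotient.inductionOn with
  | _ μ =>
  induction μ using Quotient.inductionOn with
  | _ x =>
  refine ⟨x.1, congrArg FrobGrowthDecay.mk (congrArg GrowthDecay.mk (Subtype.ext ?_))⟩
  exact abs_of_nonneg x.2

theorem zero_mem_approxSet (μ : FrobGrowthDecay U) (θ : ℝ) (d : UPow U ℕ) :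
    0 ∈ approxSet μ θ d := by
  refine ⟨?_, ?_, Or.inl rfl⟩
  · have h : starEval θ (0 : UPow U ℤ[X]) = 0 :=
      Germ.coe_eq.2 (Eventually.of_forall fun i => map_zero (aeval θ))
    rw [h]
    exact isInfinitesimal_zero
  · induction d using Germ.inductionOn with
    | _ d => exact Eventually.of_forall fun i => natDegree_zero.trans_le (Nat.zero_le _)

theorem IsDecay.isInfinitesimal {x : UPow U ℝ} (h : IsDecay (frobClass x)) :
    IsInfinitesimal x := by
  obtain ⟨z, hz, hzx⟩ := h
  obtain ⟨n, -, hn⟩ := exists_pow_le_of_frobClass_le hz (Or.inr hzx.symm)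
  refine IsInfinitesimal.of_pow (n := n) (hz.of_abs_le ?_)
  rwa [abs_pow]

theorem isInfinitesimal_of_frobClass_le {x y : UPow U ℝ} (hx : IsInfinitesimal x)
    (h : frobClass y ≤ frobClass x) : IsInfinitesimal y := by
  obtain ⟨n, -, hn⟩ := exists_pow_le_of_frobClass_le hx h
  refine IsInfinitesimal.of_pow (n := n) (hx.of_abs_le ?_)
  rwa [abs_pow]

theorem DecaysFasterThanPowers.of_frobClass_le {x y c : UPow U ℝ} (hx : IsInfinitesimal x)
    (hc : 0 ≤ c) (h : DecaysFasterThanPowers |x| c) (hyx : frobClass y ≤ frobClass x) :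
    DecaysFasterThanPowers |y| c := by
  obtain ⟨n, hn0, hn⟩ := exists_pow_le_of_frobClass_le hx hyx
  exact h.of_pow_le hn0 (abs_nonneg y) hc hn

/-- Membership in `approxIdeal` with the growth condition in terms of representatives. -/
theorem mem_approxIdeal_iff_of_ne_zero {x y : UPow U ℝ} {e d : UPow U ℕ} {θ : ℝ} {f : UPow U ℤ[X]}
    (hx : IsInfinitesimal x) (hf : f ≠ 0) :
    f ∈ approxIdeal (frobClass x) (frobClass y) e θ d ↔
      IsInfinitesimal (starEval θ f) ∧ starDeg f ≤ d ∧
        DecaysFasterThanPowers |x| (rootHeight d f) ∧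
        frobClass (rootValue θ d e f) ≤ frobClass y := by
  rw [← frobClass_lt_inv_iff hx (one_le_rootHeight d hf)]
  simp only [approxIdeal, approxSet, Set.mem_ofPred_eq, hf, false_or, and_assoc]
  rfl

theorem starResultantProduct_mem {μ ν : FrobGrowthDecay U} (hμ : IsDecay μ) (hνμ : ν ≤ μ)
    {θ η : ℝ} {d e : UPow U ℕ} (hd : 1 ≤ d) (he : 1 ≤ e) {f g : UPow U ℤ[X]}
    (hf : f ∈ approxIdeal μ ν e θ d) (hg : g ∈ approxIdeal ν ν d η e) :
    f ⊠ g ∈ approxSet ν (θ * η) (d * e) := by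
  by_cases hf0 : f = 0
  · rw [hf0, starResultantProduct_zero_left]; exact zero_mem_approxSet _ _ _
  by_cases hg0 : g = 0
  · rw [hg0, starResultantProduct_comm, starResultantProduct_zero_left]
    exact zero_mem_approxSet _ _ _
  obtain ⟨x, rfl⟩ := frobClass_surjective μ
  obtain ⟨y, rfl⟩ := frobClass_surjective ν
  have hx := hμ.isInfinitesimal
  have hy := isInfinitesimal_of_frobClass_le hx hνμ
  obtain ⟨hfθ, hfd, hfA, hfF⟩ := (mem_approxIdeal_iff_of_ne_zero hx hf0).1 hf
  obtain ⟨hgη, hgd, hgB, hgG⟩ := (mem_approxIdeal_iff_of_ne_zero hy hg0).1 hg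
  have hA := zero_le_one.trans (one_le_rootHeight d hf0)
  have hB := zero_le_one.trans (one_le_rootHeight e hg0)
  have hyA := hfA.of_frobClass_le hx hA hνμ
  have key : ∀ z : UPow U ℝ, 0 ≤ z → frobClass z ≤ frobClass y →
      IsInfinitesimal (z * (rootHeight d f * rootHeight e g)) := by
    intro z hz hzy
    have h := (hyA.mul (abs_nonneg y) hA hB hgB).of_frobClass_le hy (mul_nonneg hA hB) hzy
    rw [abs_of_nonneg hz] at h
    exact h.isInfinitesimal_mul hz (isInfinitesimal_of_frobClass_le hy hzy)
  exact starResultantProduct_mem_approxSet hd he hf0 hg0 hfd hgd hfθ hgη hy hyA hgB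
    (key _ (rootValue_nonneg _ _ _ _) hfF) (Or.inl (key _ (rootValue_nonneg _ _ _ _) hgG))

/-- A linear factor `f` allows a weaker condition on the values of `g`: the value of `g` has to
compensate for the height of `f` only. -/
theorem starResultantProduct_mem_of_linear {μ ν : FrobGrowthDecay U} (hμ : IsDecay μ)
    (hνμ : ν ≤ μ) {θ η : ℝ} {e : UPow U ℕ} (he : 1 ≤ e) {f g : UPow U ℤ[X]}
    (hf : f ∈ approxIdeal μ ν e θ 1) (hg : g ∈ approxIdeal ν μ 1 η e) :
    f ⊠ g ∈ approxSet ν (θ * η) e := by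
  by_cases hf0 : f = 0
  · rw [hf0, starResultantProduct_zero_left]; exact zero_mem_approxSet _ _ _
  by_cases hg0 : g = 0
  · rw [hg0, starResultantProduct_comm, starResultantProduct_zero_left]
    exact zero_mem_approxSet _ _ _
  obtain ⟨x, rfl⟩ := frobClass_surjective μ
  obtain ⟨y, rfl⟩ := frobClass_surjective ν
  have hx := hμ.isInfinitesimal
  have hy := isInfinitesimal_of_frobClass_le hx hνμ
  obtain ⟨hfθ, hfd, hfA, hfF⟩ := (mem_approxIdeal_iff_of_ne_zero hx hf0).1 hf
  obtain ⟨hgη, hgd, hgB, hgG⟩ := (mem_approxIdeal_iff_of_ne_zero hy hg0).1 hg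
  have hA := zero_le_one.trans (one_le_rootHeight 1 hf0)
  have hB := zero_le_one.trans (one_le_rootHeight e hg0)
  have hyA := hfA.of_frobClass_le hx hA hνμ
  have hF0 := rootValue_nonneg θ 1 e f
  have hG0 := rootValue_nonneg η e 1 g
  have hF := (hyA.mul (abs_nonneg y) hA hB hgB).of_frobClass_le hy (mul_nonneg hA hB) hfF
  have hG := hfA.of_frobClass_le hx hA hgG
  rw [abs_of_nonneg hF0] at hF
  rw [abs_of_nonneg hG0] at hG
  have h := starResultantProduct_mem_approxSet le_rfl he hf0 hg0 hfd hgd hfθ hgη hy hyA hgB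
    (hF.isInfinitesimal_mul hF0 (isInfinitesimal_of_frobClass_le hy hfF))
    (Or.inr ⟨rfl, by
      rw [mul_one]
      exact hG.isInfinitesimal_mul hG0 (isInfinitesimal_of_frobClass_le hx hgG)⟩)
  rwa [one_mul] at h

/-- A root of standard order does not change a Frobenius class. -/
theorem approxIdeal_natCast {e : ℕ} (he : 1 ≤ e) (μ ν : FrobGrowthDecay U) (θ : ℝ)
    (d : UPow U ℕ) : approxIdeal μ ν (e : UPow U ℕ) θ d = approxIdeal μ ν 1 θ d := by
  have hroot : ∀ n : ℕ, 1 ≤ n → ∀ f : UPow U ℤ[X], decayRoot θ d (n : UPow U ℕ) f =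
      frobClass (starPow |starEval θ f| (natToReal d)⁻¹) := fun n hn f =>
    frobClass_starPow (starPow_nonneg (abs_nonneg _) _)
      (isPosUnit_natCast (Nat.one_le_iff_ne_zero.1 hn)).inv
  have h1 := hroot 1 le_rfl
  rw [Nat.cast_one] at h1
  simp only [approxIdeal, hroot e he, h1]

theorem one_le_natCast {e : ℕ} (he : 1 ≤ e) : (1 : UPow U ℕ) ≤ (e : UPow U ℕ) :=
  Germ.const_le (x := 1) (y := e) he

theorem starResultantProduct_mul_left (f f' g : UPow U ℤ[X]) :
    (f * f') ⊠ g = (f ⊠ g) * (f' ⊠ g) := by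
  induction f, f', g using Germ.inductionOn₃ with
  | _ f f' g =>
    exact Germ.coe_eq.2 (Eventually.of_forall fun i => resultantProduct_mul_left _ _ _)

theorem starResultantProduct_linear {b a b' a' : UPow U ℤ} (hb : b ≠ 0) (hb' : b' ≠ 0) :
    starLinear b a ⊠ starLinear b' a' = starLinear (b * b') (a * a') := by
  induction b, a using Germ.inductionOn₂ with
  | _ b a =>
  induction b', a' using Germ.inductionOn₂ with
  | _ b' a' =>
  exact Germ.coe_eq.2 (((germ_ne_zero_iff.1 hb).and (germ_ne_zero_iff.1 hb')).mono
    fun i hi => resultantProduct_linear hi.1 hi.2)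

end Products

end PolyApprox

open PolyApprox
theorem theorem6p4 (U : Ultrafilter ℕ) (hU : (U : Filter ℕ) ≤ Filter.cofinite)
    (θ η : ℝ) (μ ν : FrobGrowthDecay U) (hμ : IsDecay μ) (hνμ : ν ≤ μ) :
    -- arbitrary, possibly infinite, degrees
    (∀ d e : UPow U ℕ, 1 ≤ d → 1 ≤ e →
      ∀ f ∈ approxIdeal μ ν e θ d, ∀ g ∈ approxIdeal ν ν d η e,
        f ⊠ g ∈ approxSet ν (θ * η) (d * e)) ∧
    -- the adjusted indices for `d = 1`
    (∀ e : UPow U ℕ, 1 ≤ e →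
      ∀ f ∈ approxIdeal μ ν e θ 1, ∀ g ∈ approxIdeal ν μ 1 η e,
        f ⊠ g ∈ approxSet ν (θ * η) e) ∧
    -- the adjusted indices for `e = 1`
    (∀ d : UPow U ℕ, 1 ≤ d →
      ∀ f ∈ approxIdeal ν μ 1 θ d, ∀ g ∈ approxIdeal μ ν d η 1,
        f ⊠ g ∈ approxSet ν (θ * η) d) ∧
    -- finite degrees
    (∀ d e : ℕ, 1 ≤ d → 1 ≤ e →
      ∀ f ∈ approxIdeal μ ν 1 θ (d : UPow U ℕ), ∀ g ∈ approxIdeal ν ν 1 η (e : UPow U ℕ),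
        f ⊠ g ∈ approxSet ν (θ * η) ((d * e : ℕ) : UPow U ℕ)) ∧
    -- finite degrees, `d = 1`
    (∀ e : ℕ, 1 ≤ e →
      ∀ f ∈ approxIdeal μ ν 1 θ (1 : UPow U ℕ), ∀ g ∈ approxIdeal ν μ 1 η (e : UPow U ℕ),
        f ⊠ g ∈ approxSet ν (θ * η) (e : UPow U ℕ)) ∧
    -- finite degrees, `e = 1`
    (∀ d : ℕ, 1 ≤ d →
      ∀ f ∈ approxIdeal ν μ 1 θ (d : UPow U ℕ), ∀ g ∈ approxIdeal μ ν 1 η (1 : UPow U ℕ),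
        f ⊠ g ∈ approxSet ν (θ * η) (d : UPow U ℕ)) ∧
    -- `d = e = 1`: this is the product of numerator-denominator pairs
    (∀ b a b' a' : UPow U ℤ, b ≠ 0 → b' ≠ 0 →
      starLinear b a ⊠ starLinear b' a' = starLinear (b * b') (a * a')) ∧
    -- bilinearity with respect to the usual product of polynomials
    (∀ f f' g : UPow U (Polynomial ℤ), (f * f') ⊠ g = (f ⊠ g) * (f' ⊠ g)) ∧
    (∀ f g g' : UPow U (Polynomial ℤ), f ⊠ (g * g') = (f ⊠ g) * (f ⊠ g')) ∧
    -- the resultant product of nonzero polynomials is nonzero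
    (∀ f g : UPow U (Polynomial ℤ), f ≠ 0 → g ≠ 0 → f ⊠ g ≠ 0) := by
  have swap : ∀ d : UPow U ℕ, 1 ≤ d → ∀ f ∈ approxIdeal ν μ 1 θ d, ∀ g ∈ approxIdeal μ ν d η 1,
      f ⊠ g ∈ approxSet ν (θ * η) d := by
    intro d hd f hf g hg
    rw [starResultantProduct_comm, mul_comm θ]
    exact starResultantProduct_mem_of_linear hμ hνμ hd hg hf
  refine ⟨fun d e hd he f hf g hg => starResultantProduct_mem hμ hνμ hd he hf hg,
    fun e he f hf g hg => starResultantProduct_mem_of_linear hμ hνμ he hf hg, swap, ?_, ?_, ?_,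
    fun b a b' a' hb hb' => starResultantProduct_linear hb hb', starResultantProduct_mul_left, ?_,
    fun f g hf hg => starResultantProduct_ne_zero hf hg⟩
  · intro d e hd he f hf g hg
    rw [← approxIdeal_natCast he] at hf
    rw [← approxIdeal_natCast hd] at hg
    rw [Nat.cast_mul]
    exact starResultantProduct_mem hμ hνμ (one_le_natCast hd) (one_le_natCast he) hf hg
  · intro e he f hf g hg
    rw [← approxIdeal_natCast he] at hf
    exact starResultantProduct_mem_of_linear hμ hνμ (one_le_natCast he) hf hg
  · intro d hd f hf g hg
    rw [← approxIdeal_natCast hd] at hg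
    exact swap d (one_le_natCast hd) f hf g hg
  · intro f g g'
    simp only [starResultantProduct_comm f, starResultantProduct_mul_left]
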